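/- Let $m$ and $n$ be positive integers and let $d = \gcd(m, n)$. The $m \times n$ grid is the plane graph whose vertices are the integer points $(x, y)$ with $1 \le x \le m$ and $1 \le y \le n$ and whose edges are the unit segments between these points; its cells are the unit squares bounded by its edges. The signature of a cycle $C$ in the grid is the function which assigns to each cell the number of edges of that cell which belong to $C$. Every cycle on the $m \times n$ grid is uniquely determined by its signature (that is, any two cycles on the grid with the same signature coincide) if and only if $m$ and $n$ satisfy one or more of the following conditions: (a) $m \le 2$ or $n \le 2$; (b) $d = 1$; (c) $d = 2$ and $m \equiv n \equiv 2 \pmod 4$. Conversely, there exist two distinct cycles on the $m \times n$ grid with the same signature if and only if $m$ and $n$ satisfy all three of the following conditions: (a$'$) $m \ge 3$ and $n \ge 3$; (b$'$) $d \ge 2$; (c$'$) if $d = 2$, then $m \equiv 0 \pmod 4$ or $n \equiv 0 \pmod 4$. -/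

import Mathlib

namespace Slitherlink

/-- The square lattice: two integer points are adjacent when they are the endpoints of a unit
segment. -/
def lattice : SimpleGraph (ℤ × ℤ) where
  Adj p q :=
    (p.1 = q.1 ∧ (p.2 = q.2 + 1 ∨ q.2 = p.2 + 1)) ∨
      (p.2 = q.2 ∧ (p.1 = q.1 + 1 ∨ q.1 = p.1 + 1))
  symm := ⟨fun p q h => by omega⟩
  loopless := ⟨fun p h => by omega⟩

/-- The grid of size `m × n`, counted by vertices: its vertices are the integer points `(x, y)`
with `1 ≤ x ≤ m` and `1 ≤ y ≤ n`, and its edges are the unit segments between these points. -/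
def grid (m n : ℕ) : lattice.Subgraph :=
  (⊤ : lattice.Subgraph).induce {p | 1 ≤ p.1 ∧ p.1 ≤ m ∧ 1 ≤ p.2 ∧ p.2 ≤ n}

/-- `C` is a cycle in the `m × n` grid: it is a subgraph of the grid, and it consists of the
vertices and the edges of a closed walk which is a cycle. -/
def IsGridCycle (m n : ℕ) (C : lattice.Subgraph) : Prop :=
  C ≤ grid m n ∧ ∃ (v : ℤ × ℤ) (w : lattice.Walk v v), w.IsCycle ∧ w.toSubgraph = C

/-- The cells (the finite faces) of the `m × n` grid; each unit square is represented by its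
lower left vertex. -/
def cells (m n : ℕ) : Set (ℤ × ℤ) :=
  {c | 1 ≤ c.1 ∧ c.1 + 1 ≤ m ∧ 1 ≤ c.2 ∧ c.2 + 1 ≤ n}

/-- The lower, upper, left and right edges of the cell with lower left vertex `c`. -/
def cellEdges (c : ℤ × ℤ) : Set (Sym2 (ℤ × ℤ)) :=
  {s((c.1, c.2), (c.1 + 1, c.2)), s((c.1, c.2 + 1), (c.1 + 1, c.2 + 1)),
    s((c.1, c.2), (c.1, c.2 + 1)), s((c.1 + 1, c.2), (c.1 + 1, c.2 + 1))}

/-- The signature of `C` in the `m × n` grid: it assigns to each cell the number of edges of that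
cell which belong to `C`. -/
noncomputable def signature (m n : ℕ) (C : lattice.Subgraph) : cells m n → ℕ :=
  fun c => (cellEdges c ∩ C.edgeSet).ncard

end Slitherlink

/-! Suppose that two cycles have the same signature, and compare their interiors. Counted modulo 2,
the cells which lie inside exactly one of the cycles form a function whose sums over the two pairs
of opposite neighbours of a cell agree: a solution of the discrete wave equation, with value zero
outside the grid. Unfolding the grid like a billiard table extends it to a solution on the whole
plane which is even and periodic in both coordinates, hence `2d`-periodic, and which vanishes where
a coordinate is a multiple of `d`. So it is zero if `d = 1`; if `d = 2`, it is constant on the cells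
whose two coordinates are odd, and zero elsewhere.

In the latter case let `m = 2P` and `n = 2Q`. Each odd cell is then inside exactly one of the two
cycles, the odd cells partition the vertices into `2 × 2` blocks, and the permutations which move
each vertex one step along the first and along the second cycle, both oriented with the interior on
the same side, differ by a permutation inside each block. Comparing signs and numbers of fixed
points shows that `P * Q` is even.

Conversely, a pair of distinct cycles with equal signatures on a small grid can be repeated
periodically by reflecting it and merging the copies along the common sides. The small grids are
`4 × 4`, `6 × 4` and the `e × e` grids with `e` odd; on the latter the cycles are assembled from
pairs on `3 × 3` grids along the diagonal. -/

namespace Slitherlink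

open Set (indicator)

/-! ### Signatures as sums of edge indicators -/

/-- The horizontal edge from `(x, y)` to `(x + 1, y)`. -/
def hEdge (x y : ℤ) : Sym2 (ℤ × ℤ) := s((x, y), (x + 1, y))

/-- The vertical edge from `(x, y)` to `(x, y + 1)`. -/
def vEdge (x y : ℤ) : Sym2 (ℤ × ℤ) := s((x, y), (x, y + 1))

section EdgeSums

variable {R : Type*} [AddCommGroupWithOne R]

/-- The sum of an edge function over the four edges of the cell `(x, y)`. -/
def cellSum (f : Sym2 (ℤ × ℤ) → R) (x y : ℤ) : R :=
  f (hEdge x y) + f (hEdge x (y + 1)) + f (vEdge x y) + f (vEdge (x + 1) y)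

/-- The sum of an edge function over the four edges at the vertex `(x, y)`. -/
def vertexSum (f : Sym2 (ℤ × ℤ) → R) (x y : ℤ) : R :=
  f (hEdge (x - 1) y) + f (hEdge x y) + f (vEdge x (y - 1)) + f (vEdge x y)

theorem cellSum_add (f g : Sym2 (ℤ × ℤ) → R) (x y : ℤ) :
    cellSum (f + g) x y = cellSum f x y + cellSum g x y := by
  simp only [cellSum, Pi.add_apply]; abel

theorem cellSum_sub (f g : Sym2 (ℤ × ℤ) → R) (x y : ℤ) :
    cellSum (f - g) x y = cellSum f x y - cellSum g x y := by
  simp only [cellSum, Pi.sub_apply]; abel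

theorem natCast_ncard_inter_four {α : Type*} {a b c d : α} (hab : a ≠ b) (hac : a ≠ c)
    (had : a ≠ d) (hbc : b ≠ c) (hbd : b ≠ d) (hcd : c ≠ d) (T : Set α) :
    ((({a, b, c, d} : Set α) ∩ T).ncard : R) =
      indicator T 1 a + indicator T 1 b + indicator T 1 c + indicator T 1 d := by
  classical
  have h : ({a, b, c, d} : Set α) ∩ T = ↑(({a, b, c, d} : Finset α).filter (· ∈ T)) := by
    ext; simp
  rw [h, Set.ncard_coe_finset, Finset.natCast_card_filter, Finset.sum_insert (by simp [*]),
    Finset.sum_insert (by simp [*]), Finset.sum_insert (by simp [*]), Finset.sum_singleton]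
  simp only [Set.indicator_apply, Pi.one_apply, add_assoc]

theorem natCast_ncard_cellEdges_inter (E : Set (Sym2 (ℤ × ℤ))) (x y : ℤ) :
    ((cellEdges (x, y) ∩ E).ncard : R) = cellSum (indicator E 1) x y :=
  natCast_ncard_inter_four (by simp) (by simp) (by simp) (by simp) (by simp) (by simp) E

theorem lattice_adj_iff {x y : ℤ} {q : ℤ × ℤ} : lattice.Adj (x, y) q ↔
    q = (x - 1, y) ∨ q = (x + 1, y) ∨ q = (x, y - 1) ∨ q = (x, y + 1) := by
  obtain ⟨a, b⟩ := q
  simp only [lattice, Prod.mk.injEq]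
  omega

theorem hEdge_sub_one (x y : ℤ) : hEdge (x - 1) y = s((x, y), (x - 1, y)) := by
  rw [hEdge, sub_add_cancel, Sym2.eq_swap]

theorem vEdge_sub_one (x y : ℤ) : vEdge x (y - 1) = s((x, y), (x, y - 1)) := by
  rw [vEdge, sub_add_cancel, Sym2.eq_swap]

theorem natCast_ncard_neighborSet (C : lattice.Subgraph) (x y : ℤ) :
    ((C.neighborSet (x, y)).ncard : R) = vertexSum (indicator C.edgeSet 1) x y := by
  have hs : C.neighborSet (x, y) =
      {(x - 1, y), (x + 1, y), (x, y - 1), (x, y + 1)} ∩ C.neighborSet (x, y) := by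
    refine (Set.inter_eq_right.2 fun q hq => ?_).symm
    simpa using lattice_adj_iff.1 (C.adj_sub hq)
  have hedge (q : ℤ × ℤ) : indicator (C.neighborSet (x, y)) (1 : ℤ × ℤ → R) q =
      indicator C.edgeSet 1 s((x, y), q) := rfl
  rw [hs, natCast_ncard_inter_four (by simp; omega) (by simp) (by simp) (by simp) (by simp)
    (by simp; omega)]
  rw [hedge, hedge, hedge, hedge, vertexSum, hEdge_sub_one, vEdge_sub_one, hEdge, vEdge]

end EdgeSums

theorem mem_cells {m n : ℕ} {x y : ℤ} :
    (x, y) ∈ cells m n ↔ 1 ≤ x ∧ x + 1 ≤ m ∧ 1 ≤ y ∧ y + 1 ≤ n := Iff.rfl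

theorem mem_verts_grid {m n : ℕ} {p : ℤ × ℤ} :
    p ∈ (grid m n).verts ↔ 1 ≤ p.1 ∧ p.1 ≤ m ∧ 1 ≤ p.2 ∧ p.2 ≤ n := Iff.rfl

theorem cellSum_eq_of_signature_eq {m n : ℕ} {C₁ C₂ : lattice.Subgraph}
    (h : signature m n C₁ = signature m n C₂) (R : Type*) [AddCommGroupWithOne R] {x y : ℤ}
    (hxy : (x, y) ∈ cells m n) :
    cellSum (R := R) (indicator C₁.edgeSet 1) x y = cellSum (indicator C₂.edgeSet 1) x y := by
  rw [← natCast_ncard_cellEdges_inter, ← natCast_ncard_cellEdges_inter]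
  exact congrArg Nat.cast (congrFun h ⟨(x, y), hxy⟩)

theorem signature_eq_iff {m n : ℕ} {C₁ C₂ : lattice.Subgraph} (R : Type*) [AddCommGroupWithOne R]
    [CharZero R] : signature m n C₁ = signature m n C₂ ↔ ∀ x y, (x, y) ∈ cells m n →
      cellSum (R := R) (indicator C₁.edgeSet 1) x y = cellSum (indicator C₂.edgeSet 1) x y := by
  refine ⟨fun h x y => cellSum_eq_of_signature_eq h R, fun h => ?_⟩
  funext ⟨⟨x, y⟩, hxy⟩
  have hcell := h x y hxy
  rwa [← natCast_ncard_cellEdges_inter, ← natCast_ncard_cellEdges_inter, Nat.cast_inj] at hcell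

theorem exists_edge_of_adj {p q : ℤ × ℤ} (h : lattice.Adj p q) :
    ∃ x y, s(p, q) = hEdge x y ∨ s(p, q) = vEdge x y := by
  obtain ⟨x, y⟩ := p
  rcases lattice_adj_iff.1 h with rfl | rfl | rfl | rfl
  · exact ⟨x - 1, y, .inl (hEdge_sub_one x y).symm⟩
  · exact ⟨x, y, .inl rfl⟩
  · exact ⟨x, y - 1, .inr (vEdge_sub_one x y).symm⟩
  · exact ⟨x, y, .inr rfl⟩

theorem edgeSet_ext {C₁ C₂ : lattice.Subgraph}
    (hh : ∀ x y, hEdge x y ∈ C₁.edgeSet ↔ hEdge x y ∈ C₂.edgeSet)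
    (hv : ∀ x y, vEdge x y ∈ C₁.edgeSet ↔ vEdge x y ∈ C₂.edgeSet) :
    C₁.edgeSet = C₂.edgeSet := by
  ext e
  induction e using Sym2.ind with
  | _ p q =>
    by_cases hpq : lattice.Adj p q
    · obtain ⟨x, y, he | he⟩ := exists_edge_of_adj hpq <;> rw [he]
      exacts [hh x y, hv x y]
    · exact ⟨fun he => (hpq (C₁.adj_sub he)).elim, fun he => (hpq (C₂.adj_sub he)).elim⟩

namespace IsGridCycle

variable {m n : ℕ} {C : lattice.Subgraph}

theorem box (h : IsGridCycle m n C) {p : ℤ × ℤ} (hp : p ∈ C.verts) :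
    1 ≤ p.1 ∧ p.1 ≤ m ∧ 1 ≤ p.2 ∧ p.2 ≤ n := h.1.1 hp

theorem hEdge_box (h : IsGridCycle m n C) {x y : ℤ} (he : hEdge x y ∈ C.edgeSet) :
    1 ≤ x ∧ x + 1 ≤ m ∧ 1 ≤ y ∧ y ≤ n := by
  have hleft := h.box (C.edge_vert he)
  have hright := h.box (C.edge_vert (C.adj_symm he))
  dsimp only at hleft hright
  omega

theorem vEdge_box (h : IsGridCycle m n C) {x y : ℤ} (he : vEdge x y ∈ C.edgeSet) :
    1 ≤ x ∧ x ≤ m ∧ 1 ≤ y ∧ y + 1 ≤ n := by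
  have hlower := h.box (C.edge_vert he)
  have hupper := h.box (C.edge_vert (C.adj_symm he))
  dsimp only at hlower hupper
  omega

theorem verts_nonempty (h : IsGridCycle m n C) : C.verts.Nonempty := by
  obtain ⟨-, v, w, -, rfl⟩ := h
  exact ⟨v, by simp⟩

theorem ncard_neighborSet (h : IsGridCycle m n C) {p : ℤ × ℤ} (hp : p ∈ C.verts) :
    (C.neighborSet p).ncard = 2 := by
  obtain ⟨-, v, w, hw, rfl⟩ := h
  exact hw.ncard_neighborSet_toSubgraph_eq_two (by simpa using hp)

theorem exists_adj (h : IsGridCycle m n C) {p : ℤ × ℤ} (hp : p ∈ C.verts) :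
    ∃ q, C.Adj p q :=
  Set.nonempty_of_ncard_ne_zero (s := C.neighborSet p) (by rw [h.ncard_neighborSet hp]; decide)

theorem even_ncard_neighborSet (h : IsGridCycle m n C) (p : ℤ × ℤ) :
    Even (C.neighborSet p).ncard := by
  by_cases hp : p ∈ C.verts
  · rw [h.ncard_neighborSet hp]
    exact even_two
  · have hempty : C.neighborSet p = ∅ :=
      Set.eq_empty_of_forall_notMem fun q hq => hp (C.edge_vert hq)
    rw [hempty, Set.ncard_empty]
    exact Even.zero

theorem eq_of_edgeSet_eq {C' : lattice.Subgraph} (h : IsGridCycle m n C)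
    (h' : IsGridCycle m n C') (he : C.edgeSet = C'.edgeSet) : C = C' := by
  have hadj (p q) : C.Adj p q ↔ C'.Adj p q := by
    rw [← SimpleGraph.Subgraph.mem_edgeSet, he, SimpleGraph.Subgraph.mem_edgeSet]
  ext p q
  · exact ⟨fun hp => (h.exists_adj hp).elim fun q hq => C'.edge_vert ((hadj p q).1 hq),
      fun hp => (h'.exists_adj hp).elim fun q hq => C.edge_vert ((hadj p q).2 hq)⟩
  · exact hadj p q

theorem verts_subset (h : IsGridCycle m n C) {S : Set (ℤ × ℤ)} {p : ℤ × ℤ} (hp : p ∈ C.verts)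
    (hpS : p ∈ S) (hS : ∀ a b, a ∈ S → C.Adj a b → b ∈ S) : C.verts ⊆ S := by
  intro q hq
  have hconn : C.Connected := by
    obtain ⟨-, v, w, -, rfl⟩ := h
    exact w.toSubgraph_connected
  have hreach := hconn.preconnected.coe ⟨p, hp⟩ ⟨q, hq⟩
  rw [SimpleGraph.reachable_iff_reflTransGen] at hreach
  have hmem (z : C.verts) (hz : Relation.ReflTransGen C.coe.Adj ⟨p, hp⟩ z) : z.1 ∈ S := by
    induction hz with
    | refl => exact hpS
    | tail _ hbc ih => exact hS _ _ ih hbc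
  exact hmem _ hreach

end IsGridCycle

/-! ### The interior of a cycle -/

/-- `g` is the indicator function modulo 2 of the set of cells which `C` encloses: the two cells
beside an edge take different values exactly when the edge belongs to `C`. -/
structure IsInterior (m n : ℕ) (C : lattice.Subgraph) (g : ℤ → ℤ → ZMod 2) : Prop where
  vert : ∀ x y, g (x - 1) y + g x y = indicator C.edgeSet 1 (vEdge x y)
  horiz : ∀ x y, g x (y - 1) + g x y = indicator C.edgeSet 1 (hEdge x y)
  outside : ∀ x y, (x, y) ∉ cells m n → g x y = 0

/-- The parity of the number of edges of `C` which the ray from the centre of the cell `(x, y)` to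
the right crosses, for a subgraph `C` to the left of the line of abscissa `m + 1`. -/
noncomputable def rayParity (m : ℕ) (C : lattice.Subgraph) (x y : ℤ) : ZMod 2 :=
  ∑ t ∈ Finset.Ioc x m, indicator C.edgeSet 1 (vEdge t y)

theorem rayParity_eq_zero_of_le {m : ℕ} (C : lattice.Subgraph) {x : ℤ} (y : ℤ) (hx : m ≤ x) :
    rayParity m C x y = 0 := by
  rw [rayParity, Finset.Ioc_eq_empty_of_le hx, Finset.sum_empty]

namespace IsGridCycle

variable {m n : ℕ} {C : lattice.Subgraph}

theorem indicator_vEdge_eq_zero (h : IsGridCycle m n C) {x y : ℤ}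
    (hxy : ¬(1 ≤ x ∧ x ≤ m ∧ 1 ≤ y ∧ y + 1 ≤ n)) :
    indicator C.edgeSet (1 : Sym2 (ℤ × ℤ) → ZMod 2) (vEdge x y) = 0 :=
  Set.indicator_of_notMem (fun he => hxy (h.vEdge_box he)) _

theorem indicator_hEdge_eq_zero (h : IsGridCycle m n C) {x y : ℤ}
    (hxy : ¬(1 ≤ x ∧ x + 1 ≤ m ∧ 1 ≤ y ∧ y ≤ n)) :
    indicator C.edgeSet (1 : Sym2 (ℤ × ℤ) → ZMod 2) (hEdge x y) = 0 :=
  Set.indicator_of_notMem (fun he => hxy (h.hEdge_box he)) _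

theorem vertexSum_eq_zero (h : IsGridCycle m n C) (x y : ℤ) :
    vertexSum (R := ZMod 2) (indicator C.edgeSet 1) x y = 0 := by
  rw [← natCast_ncard_neighborSet]
  exact (h.even_ncard_neighborSet (x, y)).natCast_zmod_two

theorem rayParity_sub_one_left (h : IsGridCycle m n C) (x y : ℤ) :
    rayParity m C (x - 1) y = indicator C.edgeSet 1 (vEdge x y) + rayParity m C x y := by
  rcases le_or_gt x m with hx | hx
  · have hIoc : Finset.Ioc (x - 1) (m : ℤ) = insert x (Finset.Ioc x m) := by
      ext t; simp only [Finset.mem_Ioc, Finset.mem_insert]; omega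
    rw [rayParity, hIoc, Finset.sum_insert (by simp), rayParity]
  · rw [rayParity_eq_zero_of_le C y (by omega), rayParity_eq_zero_of_le C y hx.le,
      h.indicator_vEdge_eq_zero (by omega), add_zero]

/-- Since every vertex has even degree, passing a vertex on the line between two adjacent rays
changes both sides of the equation by the same amount. -/
theorem rayParity_add_rayParity (h : IsGridCycle m n C) (x y : ℤ) :
    rayParity m C x (y - 1) + rayParity m C x y = indicator C.edgeSet 1 (hEdge x y) := by
  have hright {x : ℤ} (hx : m ≤ x) :
      rayParity m C x (y - 1) + rayParity m C x y = indicator C.edgeSet 1 (hEdge x y) := by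
    rw [rayParity_eq_zero_of_le C _ hx, rayParity_eq_zero_of_le C _ hx,
      h.indicator_hEdge_eq_zero (by omega), add_zero]
  rcases le_total (m : ℤ) x with hx | hx
  · exact hright hx
  induction x, hx using Int.leInductionDown with
  | base => exact hright le_rfl
  | pred x _ ih =>
    have hdeg := h.vertexSum_eq_zero x y
    rw [vertexSum] at hdeg
    rw [h.rayParity_sub_one_left, h.rayParity_sub_one_left]
    linear_combination ih + hdeg -
      indicator C.edgeSet 1 (hEdge (x - 1) y) * CharTwo.two_eq_zero (R := ZMod 2)

theorem rayParity_eq_zero_of_row (h : IsGridCycle m n C) (x : ℤ) {y : ℤ}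
    (hy : ¬(1 ≤ y ∧ y + 1 ≤ n)) : rayParity m C x y = 0 :=
  Finset.sum_eq_zero fun _ _ => h.indicator_vEdge_eq_zero (by omega)

theorem rayParity_eq_zero_of_lt_one (h : IsGridCycle m n C) {x : ℤ} (hx : x < 1) (y : ℤ) :
    rayParity m C x y = 0 := by
  rcases le_total y 0 with hy | hy
  · exact h.rayParity_eq_zero_of_row x (by omega)
  induction y, hy using Int.leInduction with
  | base => exact h.rayParity_eq_zero_of_row x (by omega)
  | succ y _ ih =>
    have hstep := h.rayParity_add_rayParity x (y + 1)
    rwa [add_sub_cancel_right, ih, zero_add, h.indicator_hEdge_eq_zero (by omega)] at hstep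

theorem isInterior_rayParity (h : IsGridCycle m n C) : IsInterior m n C (rayParity m C) where
  vert x y := by
    rw [h.rayParity_sub_one_left, add_assoc, CharTwo.add_self_eq_zero, add_zero]
  horiz := h.rayParity_add_rayParity
  outside x y hxy := by
    rw [mem_cells] at hxy
    rcases lt_or_ge x 1 with hleft | hleft
    · exact h.rayParity_eq_zero_of_lt_one hleft y
    rcases le_or_gt (m : ℤ) x with hright | hright
    · exact rayParity_eq_zero_of_le C y hright
    · exact h.rayParity_eq_zero_of_row x (by omega)

end IsGridCycle

namespace IsInterior

variable {m n : ℕ} {C C₁ C₂ : lattice.Subgraph} {g : ℤ → ℤ → ZMod 2}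

theorem mem_iff_of_add_eq_indicator {α : Type*} {E : Set α} {e : α} {a b : ZMod 2}
    (h : a + b = indicator E 1 e) : e ∈ E ↔ a ≠ b := by
  rw [Ne, ← CharTwo.add_eq_zero, h, Set.indicator_eq_zero_iff_notMem]
  simp

theorem vEdge_mem_iff (h : IsInterior m n C g) (x y : ℤ) :
    vEdge x y ∈ C.edgeSet ↔ g (x - 1) y ≠ g x y :=
  mem_iff_of_add_eq_indicator (h.vert x y)

theorem hEdge_mem_iff (h : IsInterior m n C g) (x y : ℤ) :
    hEdge x y ∈ C.edgeSet ↔ g x (y - 1) ≠ g x y :=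
  mem_iff_of_add_eq_indicator (h.horiz x y)

theorem edgeSet_eq (h₁ : IsInterior m n C₁ g) (h₂ : IsInterior m n C₂ g) :
    C₁.edgeSet = C₂.edgeSet :=
  edgeSet_ext (fun x y => (h₁.hEdge_mem_iff x y).trans (h₂.hEdge_mem_iff x y).symm)
    fun x y => (h₁.vEdge_mem_iff x y).trans (h₂.vEdge_mem_iff x y).symm

theorem cellSum_eq (h : IsInterior m n C g) (x y : ℤ) :
    cellSum (indicator C.edgeSet 1) x y =
      g (x - 1) y + g (x + 1) y + g x (y - 1) + g x (y + 1) := by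
  have hupper := h.horiz x (y + 1)
  have hright := h.vert (x + 1) y
  rw [add_sub_cancel_right] at hupper hright
  rw [cellSum, ← h.horiz, ← h.vert, ← hupper, ← hright]
  linear_combination 2 * g x y * CharTwo.two_eq_zero (R := ZMod 2)

end IsInterior

/-! ### Waves and billiards -/

/-- The distance from `x` to the nearest multiple of `2 * m`: the position in `[0, m]` after
reflections in the multiples of `m`. -/
def fold (m : ℕ) (x : ℤ) : ℤ := min (x % (2 * m)) (2 * m - x % (2 * m))

section Fold

variable {m : ℕ} (hm : 0 < m)

include hm

theorem fold_add_mul {r : ℤ} (k : ℤ) (h0 : 0 ≤ r) (h1 : r ≤ 2 * m) :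
    fold m (r + 2 * m * k) = min r (2 * m - r) := by
  rcases h1.lt_or_eq with h1 | rfl
  · rw [fold, Int.add_mul_emod_self_left, Int.emod_eq_of_lt h0 h1]
  · rw [fold, Int.add_mul_emod_self_left, Int.emod_self]
    omega

theorem exists_eq_add_two_mul_mul (x : ℤ) :
    ∃ k r : ℤ, 0 ≤ r ∧ r < 2 * m ∧ x = r + 2 * m * k :=
  ⟨x / (2 * m), x % (2 * m), Int.emod_nonneg _ (by omega), Int.emod_lt_of_pos _ (by omega),
    (Int.emod_add_mul_ediv _ _).symm⟩

theorem fold_neg (x : ℤ) : fold m (-x) = fold m x := by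
  obtain ⟨k, r, h0, h1, rfl⟩ := exists_eq_add_two_mul_mul hm x
  rw [fold_add_mul hm _ h0 h1.le,
    show -(r + 2 * m * k) = (2 * m - r) + 2 * m * (-k - 1) by ring,
    fold_add_mul hm _ (by omega) (by omega)]
  omega

theorem fold_of_mem {x : ℤ} (h0 : 0 ≤ x) (h1 : x ≤ m) : fold m x = x := by
  have hfold := fold_add_mul hm 0 h0 (by omega)
  rw [mul_zero, add_zero] at hfold
  omega

theorem fold_sub_one_add_one (x : ℤ) :
    ((fold m x = 0 ∨ fold m x = m) ∧ fold m (x - 1) = fold m (x + 1)) ∨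
    (1 ≤ fold m x ∧ fold m x + 1 ≤ m ∧
      ((fold m (x - 1) = fold m x - 1 ∧ fold m (x + 1) = fold m x + 1) ∨
       (fold m (x - 1) = fold m x + 1 ∧ fold m (x + 1) = fold m x - 1))) := by
  obtain ⟨k, r, h0, h1, rfl⟩ := exists_eq_add_two_mul_mul hm x
  rw [fold_add_mul hm _ h0 h1.le, show r + 2 * m * k + 1 = (r + 1) + 2 * m * k by ring,
    fold_add_mul hm k (r := r + 1) (by omega) (by omega)]
  rcases h0.lt_or_eq with h0 | rfl
  · rw [show r + 2 * m * k - 1 = (r - 1) + 2 * m * k by ring,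
      fold_add_mul hm k (r := r - 1) (by omega) (by omega)]
    omega
  · rw [show 0 + 2 * m * k - 1 = (2 * m - 1) + 2 * m * (k - 1) by ring,
      fold_add_mul hm _ (r := 2 * m - 1) (by omega) (by omega)]
    omega

end Fold

theorem fold_add_period (m : ℕ) (x : ℤ) : fold m (x + 2 * m) = fold m x := by
  rw [fold, fold, Int.add_emod_right]

section Wave

variable {A : Type*} [AddCommGroup A] {F : ℤ → ℤ → A}

/-- `F` solves the discrete wave equation on the lattice `ℤ × ℤ`. -/
def IsWave (F : ℤ → ℤ → A) : Prop :=
  ∀ x y, F (x - 1) y + F (x + 1) y = F x (y - 1) + F x (y + 1)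

theorem IsWave.strip (hF : IsWave F) (i : ℕ) (x y : ℤ) :
    F x y + F (x + i + 1) (y + i - 1) = F (x + i) (y + i) + F (x + 1) (y - 1) := by
  induction i with
  | zero => simp
  | succ i ih =>
    have hstep := hF (x + i + 1) (y + i)
    simp only [add_sub_cancel_right] at hstep
    simp only [Nat.cast_succ, ← add_assoc, add_sub_cancel_right]
    linear_combination (norm := module) ih + hstep

theorem IsWave.rectangle (hF : IsWave F) (i j : ℕ) (x y : ℤ) :
    F x y + F (x + i + j) (y + i - j) = F (x + i) (y + i) + F (x + j) (y - j) := by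
  induction j with
  | zero => simp [add_comm]
  | succ j ih =>
    have hstrip := hF.strip i (x + j) (y - j)
    rw [add_right_comm x, sub_add_eq_add_sub y] at hstrip
    simp only [Nat.cast_succ, ← add_assoc, ← sub_sub]
    linear_combination (norm := module) ih + hstrip

theorem IsWave.comm (hF : IsWave F) (hx : ∀ x y, F (-x) y = -F x y)
    (hy : ∀ x y, F x (-y) = -F x y) (h0x : ∀ y, F 0 y = 0) (h0y : ∀ x, F x 0 = 0) (x y : ℤ) :
    F x y = F y x := by
  have hnat (i j : ℕ) : F i j = F j i := by
    have hrect := hF.rectangle i j (-i) j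
    rw [neg_add_cancel, h0x, sub_self, h0y, hx, zero_add, add_sub_cancel_left] at hrect
    linear_combination (norm := module) -hrect
  obtain ⟨i, rfl | rfl⟩ := x.eq_nat_or_neg <;> obtain ⟨j, rfl | rfl⟩ := y.eq_nat_or_neg <;>
    simp only [hx, hy, hnat i j]

end Wave

section CellWave

variable {R : Type*} {m n : ℕ}

/-- The extension of a function on the cells of the `m × n` grid by reflection in the lines
`x = i * m` and `y = j * n`, which unfolds the billiard trajectories in the grid. -/
def unfolding (m n : ℕ) (g : ℤ → ℤ → R) (x y : ℤ) : R := g (fold m x) (fold n y)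

variable {g : ℤ → ℤ → R}

theorem unfolding_of_mem (hm : 0 < m) (hn : 0 < n) {x y : ℤ} (hx : 0 ≤ x) (hx' : x ≤ m)
    (hy : 0 ≤ y) (hy' : y ≤ n) : unfolding m n g x y = g x y := by
  rw [unfolding, fold_of_mem hm hx hx', fold_of_mem hn hy hy']

theorem unfolding_neg_left (hm : 0 < m) (x y : ℤ) :
    unfolding m n g (-x) y = unfolding m n g x y := by rw [unfolding, fold_neg hm, unfolding]

theorem unfolding_neg_right (hn : 0 < n) (x y : ℤ) :
    unfolding m n g x (-y) = unfolding m n g x y := by rw [unfolding, fold_neg hn, unfolding]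

variable [CommRing R]

/-- `g` is supported on the cells of the `m × n` grid and solves the discrete wave equation
there. -/
structure IsCellWave (m n : ℕ) (g : ℤ → ℤ → R) : Prop where
  wave : ∀ x y, (x, y) ∈ cells m n → g (x - 1) y + g (x + 1) y = g x (y - 1) + g x (y + 1)
  outside : ∀ x y, (x, y) ∉ cells m n → g x y = 0

namespace IsCellWave

variable (hg : IsCellWave m n g) (hm : 0 < m) (hn : 0 < n)

include hg hm

theorem unfolding_zero_left (y : ℤ) : unfolding m n g 0 y = 0 :=
  hg.outside _ _ (by rw [fold_of_mem hm le_rfl (by omega), mem_cells]; omega)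

theorem unfolding_left (y : ℤ) : unfolding m n g m y = 0 :=
  hg.outside _ _ (by rw [fold_of_mem hm (by omega) le_rfl, mem_cells]; omega)

omit hm

include hn

theorem unfolding_zero_right (x : ℤ) : unfolding m n g x 0 = 0 :=
  hg.outside _ _ (by rw [fold_of_mem hn le_rfl (by omega), mem_cells]; omega)

theorem unfolding_right (x : ℤ) : unfolding m n g x n = 0 :=
  hg.outside _ _ (by rw [fold_of_mem hn (by omega) le_rfl, mem_cells]; omega)

variable [CharP R 2]

include hm

theorem isWave_unfolding : IsWave (unfolding m n g) := by
  intro x y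
  simp only [unfolding]
  rcases fold_sub_one_add_one hm x with ⟨hx, hx'⟩ | ⟨h1, h2, hx⟩
  · rw [hx', hg.outside _ (fold n (y - 1)) (by rw [mem_cells]; omega),
      hg.outside _ (fold n (y + 1)) (by rw [mem_cells]; omega), CharTwo.add_self_eq_zero,
      add_zero]
  rcases fold_sub_one_add_one hn y with ⟨hy, hy'⟩ | ⟨h3, h4, hy⟩
  · rw [hy', hg.outside (fold m (x - 1)) _ (by rw [mem_cells]; omega),
      hg.outside (fold m (x + 1)) _ (by rw [mem_cells]; omega), add_zero,
      CharTwo.add_self_eq_zero]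
  have hwave := hg.wave (fold m x) (fold n y) (mem_cells.2 ⟨h1, h2, h3, h4⟩)
  rcases hx with ⟨hl, hr⟩ | ⟨hl, hr⟩ <;> rcases hy with ⟨hd, hu⟩ | ⟨hd, hu⟩ <;>
    rw [hl, hr, hd, hu] <;> linear_combination hwave

theorem unfolding_comm (x y : ℤ) : unfolding m n g x y = unfolding m n g y x :=
  (hg.isWave_unfolding hm hn).comm
    (fun x y => by rw [unfolding_neg_left hm, CharTwo.neg_eq])
    (fun x y => by rw [unfolding_neg_right hn, CharTwo.neg_eq])
    (hg.unfolding_zero_left hm) (hg.unfolding_zero_right hn) x y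

theorem periodic_unfolding (y : ℤ) :
    Function.Periodic (unfolding m n g · y) (2 * Nat.gcd m n) := by
  have hperm : Function.Periodic (unfolding m n g · y) (2 * m) := fun x => by
    simp only [unfolding, fold_add_period]
  have hpern : Function.Periodic (unfolding m n g · y) (2 * n) := fun x => by
    change unfolding m n g _ y = unfolding m n g _ y
    rw [hg.unfolding_comm hm hn, hg.unfolding_comm hm hn x, unfolding, fold_add_period, unfolding]
  have hgcd : (2 * Nat.gcd m n : ℤ) = Nat.gcdA m n * (2 * m) + Nat.gcdB m n * (2 * n) := by
    rw [Nat.gcd_eq_gcd_ab]; ring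
  rw [hgcd]
  exact (hperm.int_mul _).add_period (hpern.int_mul _)

theorem unfolding_eq_of_modEq {x x' : ℤ} (h : x ≡ x' [ZMOD 2 * Nat.gcd m n]) (y : ℤ) :
    unfolding m n g x y = unfolding m n g x' y := by
  obtain ⟨k, hk⟩ := h.dvd
  have hper := (hg.periodic_unfolding hm hn y).int_mul k x
  rw [Int.cast_id, mul_comm k, ← hk, add_sub_cancel] at hper
  exact hper.symm

/-- One of `m` and `n` is an odd multiple of their greatest common divisor. -/
theorem unfolding_gcd (y : ℤ) : unfolding m n g (Nat.gcd m n) y = 0 := by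
  obtain ⟨a, ha⟩ := Nat.gcd_dvd_left m n
  obtain ⟨b, hb⟩ := Nat.gcd_dvd_right m n
  have hab : Nat.Coprime a b := by
    have hd := Nat.gcd_pos_of_pos_left n hm
    rw [← Nat.div_eq_of_eq_mul_right hd ha, ← Nat.div_eq_of_eq_mul_right hd hb]
    exact Nat.coprime_div_gcd_div_gcd hd
  have hodd {k c : ℕ} (hk : k = Nat.gcd m n * c) (hc : Odd c) :
      unfolding m n g (Nat.gcd m n) y = unfolding m n g k y := by
    obtain ⟨e, rfl⟩ := hc
    refine hg.unfolding_eq_of_modEq hm hn (Int.modEq_iff_dvd.2 ⟨e, ?_⟩) y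
    rw [hk]; push_cast; ring
  rcases Nat.even_or_odd a with hae | hao
  · have hbo : Odd b := Nat.not_even_iff_odd.1 fun hbe =>
      Nat.not_coprime_of_dvd_of_dvd one_lt_two hae.two_dvd hbe.two_dvd hab
    rw [hodd hb hbo, hg.unfolding_comm hm hn, hg.unfolding_right hn]
  · rw [hodd ha hao, hg.unfolding_left hm]

theorem unfolding_eq_zero_of_dvd {x : ℤ} (hx : (Nat.gcd m n : ℤ) ∣ x) (y : ℤ) :
    unfolding m n g x y = 0 := by
  obtain ⟨k, rfl⟩ := hx
  rcases Int.even_or_odd' k with ⟨l, rfl | rfl⟩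
  · rw [hg.unfolding_eq_of_modEq hm hn (x' := 0) (Int.modEq_iff_dvd.2 ⟨-l, by ring⟩) y,
      hg.unfolding_zero_left hm]
  · rw [hg.unfolding_eq_of_modEq hm hn (x' := Nat.gcd m n) (Int.modEq_iff_dvd.2 ⟨-l, by ring⟩) y,
      hg.unfolding_gcd hm hn]

theorem eq_zero_of_gcd_eq_one (hd : Nat.gcd m n = 1) (x y : ℤ) : g x y = 0 := by
  by_cases hxy : (x, y) ∈ cells m n
  · rw [mem_cells] at hxy
    rw [← unfolding_of_mem (g := g) hm hn (x := x) (y := y) (by omega) (by omega) (by omega)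
      (by omega)]
    exact hg.unfolding_eq_zero_of_dvd hm hn (by rw [hd]; exact one_dvd x) y
  · exact hg.outside x y hxy

theorem eq_ite_of_gcd_eq_two (hd : Nat.gcd m n = 2) {x y : ℤ} (hxy : (x, y) ∈ cells m n) :
    g x y = if x % 2 = 1 ∧ y % 2 = 1 then g 1 1 else 0 := by
  rw [mem_cells] at hxy
  have hodd (x y : ℤ) (hx : x % 2 = 1) : unfolding m n g x y = unfolding m n g 1 y := by
    rcases (by omega : x % 4 = 1 ∨ x % 4 = 3) with h | h
    · exact hg.unfolding_eq_of_modEq hm hn (by rw [hd]; exact h) y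
    · rw [← unfolding_neg_left hm 1]
      exact hg.unfolding_eq_of_modEq hm hn (by rw [hd]; exact h) y
  have heven (x y : ℤ) (hx : x % 2 = 0) : unfolding m n g x y = 0 :=
    hg.unfolding_eq_zero_of_dvd hm hn (by rw [hd]; exact Int.dvd_of_emod_eq_zero hx) y
  rw [← unfolding_of_mem (g := g) hm hn (x := x) (y := y) (by omega) (by omega) (by omega)
    (by omega), ← unfolding_of_mem (g := g) hm hn (x := 1) (y := 1) (by omega) (by omega)
    (by omega) (by omega)]
  split_ifs with h
  · rw [hodd x y h.1, hg.unfolding_comm hm hn, hodd y 1 h.2]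
  · rcases Int.emod_two_eq_zero_or_one x with h' | h'
    · exact heven x y h'
    · rw [hg.unfolding_comm hm hn]
      exact heven y x (by omega)

end IsCellWave

end CellWave

/-! ### The successor permutation of a cycle -/

/-- The step which a cycle takes at a vertex when it keeps its interior to the left, in terms of
the indicators of the four cells around the vertex. -/
def nextStep (ne nw sw se : ZMod 2) : ℤ × ℤ :=
  if ne = 1 ∧ se = 0 then (1, 0) else if nw = 1 ∧ ne = 0 then (0, 1) else
    if sw = 1 ∧ nw = 0 then (-1, 0) else if se = 1 ∧ sw = 0 then (0, -1) else 0

/-- Of the four cells around a vertex, exactly two opposite ones are enclosed. -/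
abbrev IsCheckerboard (ne nw sw se : ZMod 2) : Prop := ne = sw ∧ nw = se ∧ ne ≠ nw

/-- The successor of a vertex on the boundary of the set of cells with indicator `g`, with this set
to the left of the boundary. It fixes the points which do not lie on the boundary. -/
def next (g : ℤ → ℤ → ZMod 2) (p : ℤ × ℤ) : ℤ × ℤ :=
  p + nextStep (g p.1 p.2) (g (p.1 - 1) p.2) (g (p.1 - 1) (p.2 - 1)) (g p.1 (p.2 - 1))

/-- No four cells around a vertex form a checkerboard, so that the boundary of the set of cells with
indicator `g` does not touch itself. -/
def NoCheckerboard (g : ℤ → ℤ → ZMod 2) : Prop :=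
  ∀ x y, ¬IsCheckerboard (g x y) (g (x - 1) y) (g (x - 1) (y - 1)) (g x (y - 1))

theorem next_cases (g : ℤ → ℤ → ZMod 2) (x y : ℤ) :
    (g x y = 1 ∧ g x (y - 1) = 0 ∧ next g (x, y) = (x + 1, y)) ∨
    (g (x - 1) y = 1 ∧ g x y = 0 ∧ next g (x, y) = (x, y + 1)) ∨
    (g (x - 1) (y - 1) = 1 ∧ g (x - 1) y = 0 ∧ next g (x, y) = (x - 1, y)) ∨
    (g x (y - 1) = 1 ∧ g (x - 1) (y - 1) = 0 ∧ next g (x, y) = (x, y - 1)) ∨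
    (next g (x, y) = (x, y) ∧ next (g + 1) (x, y) = (x, y)) := by
  have hstep : ∀ ne nw sw se : ZMod 2,
      (ne = 1 ∧ se = 0 ∧ nextStep ne nw sw se = (1, 0)) ∨
      (nw = 1 ∧ ne = 0 ∧ nextStep ne nw sw se = (0, 1)) ∨
      (sw = 1 ∧ nw = 0 ∧ nextStep ne nw sw se = (-1, 0)) ∨
      (se = 1 ∧ sw = 0 ∧ nextStep ne nw sw se = (0, -1)) ∨
      (nextStep ne nw sw se = 0 ∧ nextStep (ne + 1) (nw + 1) (sw + 1) (se + 1) = 0) := by decide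
  rcases hstep (g x y) (g (x - 1) y) (g (x - 1) (y - 1)) (g x (y - 1)) with
    ⟨h, h', hs⟩ | ⟨h, h', hs⟩ | ⟨h, h', hs⟩ | ⟨h, h', hs⟩ | ⟨hs, hs'⟩
  · exact .inl ⟨h, h', by simp [next, hs]⟩
  · exact .inr (.inl ⟨h, h', by simp [next, hs]⟩)
  · exact .inr (.inr (.inl ⟨h, h', by simp [next, hs, ← sub_eq_add_neg]⟩))
  · exact .inr (.inr (.inr (.inl ⟨h, h', by simp [next, hs, ← sub_eq_add_neg]⟩)))
  · exact .inr (.inr (.inr (.inr ⟨by simp [next, hs], by simp [next, hs']⟩)))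

theorem next_eq_right {g : ℤ → ℤ → ZMod 2} {x y : ℤ} (h : g x y = 1) (h' : g x (y - 1) = 0) :
    next g (x, y) = (x + 1, y) := by
  simp [next, nextStep, h, h']

theorem next_eq_up {g : ℤ → ℤ → ZMod 2} {x y : ℤ} (h : g (x - 1) y = 1) (h' : g x y = 0) :
    next g (x, y) = (x, y + 1) := by
  simp [next, nextStep, h, h']

namespace NoCheckerboard

variable {g : ℤ → ℤ → ZMod 2} (hg : NoCheckerboard g)

include hg

theorem next_eq_left {x y : ℤ} (h : g (x - 1) (y - 1) = 1) (h' : g (x - 1) y = 0) :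
    next g (x, y) = (x - 1, y) := by
  have hstep : ∀ ne se : ZMod 2, ¬IsCheckerboard ne 0 1 se → nextStep ne 0 1 se = (-1, 0) := by
    decide
  have hxy := hg x y
  rw [h, h'] at hxy
  rw [next, h, h', hstep _ _ hxy, Prod.mk_add_mk, add_zero, sub_eq_add_neg]

theorem next_eq_down {x y : ℤ} (h : g x (y - 1) = 1) (h' : g (x - 1) (y - 1) = 0) :
    next g (x, y) = (x, y - 1) := by
  have hstep : ∀ ne nw : ZMod 2, ¬IsCheckerboard ne nw 0 1 → nextStep ne nw 0 1 = (0, -1) := by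
    decide
  have hxy := hg x y
  rw [h, h'] at hxy
  rw [next, h, h', hstep _ _ hxy, Prod.mk_add_mk, add_zero, sub_eq_add_neg]

theorem add_one : NoCheckerboard (g + 1) := by
  have hiff : ∀ ne nw sw se : ZMod 2, IsCheckerboard (ne + 1) (nw + 1) (sw + 1) (se + 1) →
      IsCheckerboard ne nw sw se := by decide
  exact fun x y h => hg x y (hiff _ _ _ _ h)

/-- Exchanging the interior with the exterior reverses the cycle. -/
theorem next_add_one_next (p : ℤ × ℤ) : next (g + 1) (next g p) = p := by
  obtain ⟨x, y⟩ := p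
  have hadd {a b : ℤ} {c : ZMod 2} (h : g a b = c) : (g + 1) a b = c + 1 := by rw [← h]; rfl
  rcases next_cases g x y with ⟨h, h', hn⟩ | ⟨h, h', hn⟩ | ⟨h, h', hn⟩ | ⟨h, h', hn⟩ | ⟨hn, hn'⟩ <;>
    rw [hn]
  · rw [hg.add_one.next_eq_left] <;> rw [add_sub_cancel_right]
    exacts [hadd h', hadd h]
  · rw [hg.add_one.next_eq_down] <;> rw [add_sub_cancel_right]
    exacts [hadd h', hadd h]
  · rw [next_eq_right (hadd h') (hadd h), sub_add_cancel]
  · rw [next_eq_up (hadd h') (hadd h), sub_add_cancel]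
  · exact hn'

/-- The permutation of the lattice points which moves each vertex on the boundary of a set of cells
to the next one. -/
def nextPerm : Equiv.Perm (ℤ × ℤ) where
  toFun := next g
  invFun := next (g + 1)
  left_inv := hg.next_add_one_next
  right_inv p := by
    have hgg : g + 1 + 1 = g := by
      funext x y
      exact CharTwo.add_cancel_right (g x y) 1
    simpa only [hgg] using hg.add_one.next_add_one_next p

end NoCheckerboard

section Cycle

variable {m n : ℕ} {C : lattice.Subgraph} {g : ℤ → ℤ → ZMod 2}

namespace IsInterior

theorem adj_next (h : IsInterior m n C g) {p : ℤ × ℤ} (hp : next g p ≠ p) :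
    C.Adj p (next g p) := by
  obtain ⟨x, y⟩ := p
  rcases next_cases g x y with
    ⟨h₁, h₀, hn⟩ | ⟨h₁, h₀, hn⟩ | ⟨h₁, h₀, hn⟩ | ⟨h₁, h₀, hn⟩ | ⟨hn, -⟩ <;> try rw [hn]
  · exact (h.hEdge_mem_iff x y).2 (by rw [h₁, h₀]; decide)
  · exact (h.vEdge_mem_iff x y).2 (by rw [h₁, h₀]; decide)
  · rw [← SimpleGraph.Subgraph.mem_edgeSet, ← hEdge_sub_one, h.hEdge_mem_iff, h₁, h₀]
    decide
  · rw [← SimpleGraph.Subgraph.mem_edgeSet, ← vEdge_sub_one, h.vEdge_mem_iff, h₁, h₀]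
    decide
  · exact (hp hn).elim

theorem mem_grid_of_next_ne (h : IsInterior m n C g) (hC : IsGridCycle m n C) {p : ℤ × ℤ}
    (hp : next g p ≠ p) : p ∈ (grid m n).verts ∧ next g p ∈ (grid m n).verts :=
  ⟨hC.1.1 (C.edge_vert (h.adj_next hp)), hC.1.1 (C.edge_vert (C.adj_symm (h.adj_next hp)))⟩

variable (h : IsInterior m n C g) (hC : IsGridCycle m n C)

include h hC

theorem noCheckerboard : NoCheckerboard g := by
  rintro x y ⟨hdiag, hanti, hne⟩
  have hleft : hEdge (x - 1) y ∈ C.edgeSet := (h.hEdge_mem_iff _ _).2 (by rwa [← hdiag])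
  have hright : hEdge x y ∈ C.edgeSet := (h.hEdge_mem_iff _ _).2 (by rw [← hanti]; exact hne.symm)
  have hlower : vEdge x (y - 1) ∈ C.edgeSet :=
    (h.vEdge_mem_iff _ _).2 (by rwa [← hdiag, ← hanti])
  have hupper : vEdge x y ∈ C.edgeSet := (h.vEdge_mem_iff _ _).2 hne.symm
  have hdeg := natCast_ncard_neighborSet (R := ℤ) C x y
  rw [hC.ncard_neighborSet (C.edge_vert hright), vertexSum, Set.indicator_of_mem hleft,
    Set.indicator_of_mem hright, Set.indicator_of_mem hlower, Set.indicator_of_mem hupper] at hdeg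
  norm_num at hdeg

theorem next_eq_or_of_hEdge_mem {x y : ℤ} (he : hEdge x y ∈ C.edgeSet) :
    next g (x, y) = (x + 1, y) ∨ next g (x + 1, y) = (x, y) := by
  have hne : ∀ {a b : ZMod 2}, a ≠ b → b = 1 ∧ a = 0 ∨ a = 1 ∧ b = 0 := by decide
  rcases hne ((h.hEdge_mem_iff x y).1 he) with ⟨h₁, h₀⟩ | ⟨h₁, h₀⟩
  · exact .inl (next_eq_right h₁ h₀)
  · refine .inr ?_
    rw [(h.noCheckerboard hC).next_eq_left] <;> rw [add_sub_cancel_right]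
    exacts [h₁, h₀]

theorem next_eq_or_of_vEdge_mem {x y : ℤ} (he : vEdge x y ∈ C.edgeSet) :
    next g (x, y) = (x, y + 1) ∨ next g (x, y + 1) = (x, y) := by
  have hne : ∀ {a b : ZMod 2}, a ≠ b → a = 1 ∧ b = 0 ∨ b = 1 ∧ a = 0 := by decide
  rcases hne ((h.vEdge_mem_iff x y).1 he) with ⟨h₁, h₀⟩ | ⟨h₁, h₀⟩
  · exact .inl (next_eq_up h₁ h₀)
  · refine .inr ?_
    rw [(h.noCheckerboard hC).next_eq_down] <;> rw [add_sub_cancel_right]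
    exacts [h₁, h₀]

theorem next_eq_or_of_adj {p q : ℤ × ℤ} (hpq : C.Adj p q) : next g p = q ∨ next g q = p := by
  obtain ⟨x, y⟩ := p
  have he : s((x, y), q) ∈ C.edgeSet := hpq
  rcases lattice_adj_iff.1 (C.adj_sub hpq) with rfl | rfl | rfl | rfl
  · rw [← hEdge_sub_one] at he
    simpa [or_comm] using h.next_eq_or_of_hEdge_mem hC he
  · exact h.next_eq_or_of_hEdge_mem hC he
  · rw [← vEdge_sub_one] at he
    simpa [or_comm] using h.next_eq_or_of_vEdge_mem hC he
  · exact h.next_eq_or_of_vEdge_mem hC he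

theorem isCycle_nextPerm : (h.noCheckerboard hC).nextPerm.IsCycle := by
  set τ := (h.noCheckerboard hC).nextPerm
  have hadj {p q : ℤ × ℤ} (hpq : C.Adj p q) : τ p = q ∨ τ q = p := h.next_eq_or_of_adj hC hpq
  obtain ⟨p, hp⟩ := hC.verts_nonempty
  have hmoves : τ p ≠ p := by
    intro hfix
    obtain ⟨q, hq⟩ := hC.exists_adj hp
    refine hq.ne ?_
    rcases hadj hq with hpq | hqp
    · exact hfix.symm.trans hpq
    · exact τ.injective (hfix.trans hqp.symm)
  refine ⟨p, hmoves, fun q hq => ?_⟩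
  refine hC.verts_subset (S := {q | τ.SameCycle p q}) hp (Equiv.Perm.SameCycle.refl _ _) ?_
    (C.edge_vert (h.adj_next hq))
  intro a b (ha : τ.SameCycle p a) hab
  change τ.SameCycle p b
  rcases hadj hab with rfl | rfl
  · exact Equiv.Perm.sameCycle_apply_right.2 ha
  · exact Equiv.Perm.sameCycle_apply_right.1 ha

theorem next_mem_grid_iff (p : ℤ × ℤ) : next g p ∈ (grid m n).verts ↔ p ∈ (grid m n).verts := by
  by_cases hp : next g p = p
  · rw [hp]
  · exact iff_of_true (h.mem_grid_of_next_ne hC hp).2 (h.mem_grid_of_next_ne hC hp).1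

/-- The successor permutation of a cycle on the vertices of the grid. -/
def gridPerm : Equiv.Perm (grid m n).verts :=
  (h.noCheckerboard hC).nextPerm.subtypePerm (h.next_mem_grid_iff hC)

theorem coe_gridPerm (p : (grid m n).verts) : (h.gridPerm hC p : ℤ × ℤ) = next g p := rfl

theorem isCycle_gridPerm : (h.gridPerm hC).IsCycle := by
  obtain ⟨p, hp, hq⟩ := h.isCycle_nextPerm hC
  refine ⟨⟨p, (h.mem_grid_of_next_ne hC hp).1⟩, fun hfix => hp (congrArg Subtype.val hfix),
    fun q hq' => ?_⟩
  exact Equiv.Perm.sameCycle_subtypePerm.2 (hq fun hfix => hq' (Subtype.ext hfix))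

end IsInterior

theorem even_card_support_of_isCycle {α : Type*} [Fintype α] [DecidableEq α] {f : Equiv.Perm α}
    (hf : f.IsCycle) (c : α → ZMod 2) (hc : ∀ x, f x ≠ x → c (f x) = c x + 1) :
    Even f.support.card := by
  obtain ⟨x, hx, -⟩ := id hf
  have hpow (k : ℕ) : c ((f ^ k) x) = c x + k := by
    induction k with
    | zero => simp
    | succ k ih =>
      have hmoves : f ((f ^ k) x) ≠ (f ^ k) x := by
        rwa [← Equiv.Perm.mem_support, Equiv.Perm.pow_apply_mem_support, Equiv.Perm.mem_support]
      rw [pow_succ', Equiv.Perm.mul_apply, hc _ hmoves, ih, Nat.cast_succ, add_assoc]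
  have horder := hpow (orderOf f)
  rwa [pow_orderOf_eq_one, Equiv.Perm.one_apply, left_eq_add, ZMod.natCast_eq_zero_iff_even,
    hf.orderOf] at horder

theorem intCast_add_eq_of_adj {p q : ℤ × ℤ} (h : lattice.Adj p q) :
    ((q.1 + q.2 : ℤ) : ZMod 2) = (p.1 + p.2 : ℤ) + 1 := by
  have hsum : (p.1 + p.2 + 1) % 2 = (q.1 + q.2) % 2 := by
    simp only [lattice] at h
    omega
  exact_mod_cast ((ZMod.intCast_eq_intCast_iff _ _ 2).2 hsum).symm

/-- A cycle alternates between the two classes of a chessboard colouring. -/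
theorem IsInterior.even_card_support_gridPerm [Fintype (grid m n).verts]
    [DecidableEq (grid m n).verts] (h : IsInterior m n C g) (hC : IsGridCycle m n C) :
    Even (h.gridPerm hC).support.card :=
  even_card_support_of_isCycle (h.isCycle_gridPerm hC) (fun p => (p.1.1 + p.1.2 : ℤ)) fun _ hp =>
    intCast_add_eq_of_adj (C.adj_sub (h.adj_next fun hfix => hp (Subtype.ext hfix)))

end Cycle

/-! ### Cycles which differ along the odd cells -/

/-- The indicators of the eight cells around a given cell, named by their directions. -/
structure Surroundings where
  (n e s w nw ne sw se : ZMod 2)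

/-- The surroundings of the cell `(x, y)` with respect to the indicator function `g`. -/
def surroundings (g : ℤ → ℤ → ZMod 2) (x y : ℤ) : Surroundings where
  n := g x (y + 1)
  e := g (x + 1) y
  s := g x (y - 1)
  w := g (x - 1) y
  nw := g (x - 1) (y + 1)
  ne := g (x + 1) (y + 1)
  sw := g (x - 1) (y - 1)
  se := g (x + 1) (y - 1)

/-- The position of a vertex of a cell relative to the lower left vertex. -/
def offset (v : Bool × Bool) : ℤ × ℤ := (v.1.toNat, v.2.toNat)

namespace Surroundings

/-- The successor of the vertex `v` of a cell with indicator `t`, relative to the lower left vertex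
of the cell. -/
def next (a : Surroundings) (t : ZMod 2) (v : Bool × Bool) : ℤ × ℤ :=
  offset v + match v with
  | (false, false) => nextStep t a.w a.sw a.s
  | (true, false) => nextStep a.e t a.s a.se
  | (false, true) => nextStep a.n a.nw a.w t
  | (true, true) => nextStep a.ne a.n t a.e

/-- Flipping the cell in the middle neither changes the number of boundary edges around it nor
creates a checkerboard. -/
abbrev IsAmbiguous (a : Surroundings) : Prop :=
  a.n.val + a.e.val + a.s.val + a.w.val = 2 ∧ ∀ t : ZMod 2,
    ¬IsCheckerboard t a.w a.sw a.s ∧ ¬IsCheckerboard a.e t a.s a.se ∧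
      ¬IsCheckerboard a.n a.nw a.w t ∧ ¬IsCheckerboard a.ne a.n t a.e

/-- In ambiguous surroundings, the two enclosed neighbours lie opposite each other. -/
abbrev IsOpposite (a : Surroundings) : Prop := a.n = a.s

open Equiv (swap) in
/-- The permutation of the vertices of a cell in ambiguous surroundings by which the successor
functions with and without the cell differ. -/
def squarePerm (a : Surroundings) (t : ZMod 2) : Equiv.Perm (Bool × Bool) :=
  if a.IsOpposite then
    if a.w = 1 then swap (false, false) (true, true) else swap (true, false) (false, true)
  else
    let c : Equiv.Perm (Bool × Bool) :=
      if a.w = a.s then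
        if a.w = 1 then swap (true, false) (true, true) * swap (true, true) (false, false)
        else swap (false, true) (false, false) * swap (false, false) (true, true)
      else
        if a.w = 1 then swap (false, false) (true, false) * swap (true, false) (false, true)
        else swap (true, true) (false, true) * swap (false, true) (true, false)
    if t = 1 then c else c⁻¹

theorem sign_squarePerm (a : Surroundings) (t : ZMod 2) :
    Equiv.Perm.sign (a.squarePerm t) = if a.IsOpposite then -1 else 1 := by
  unfold squarePerm
  split_ifs <;> simp [Equiv.Perm.sign_mul]

theorem next_squarePerm {a : Surroundings} (ha : a.IsAmbiguous) (t : ZMod 2) (v : Bool × Bool) :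
    a.next (t + 1) (a.squarePerm t v) = a.next t v := by
  have hall : ∀ n e s w nw ne sw se : ZMod 2, IsAmbiguous ⟨n, e, s, w, nw, ne, sw, se⟩ →
      ∀ t v, next ⟨n, e, s, w, nw, ne, sw, se⟩ (t + 1)
        (squarePerm ⟨n, e, s, w, nw, ne, sw, se⟩ t v) =
          next ⟨n, e, s, w, nw, ne, sw, se⟩ t v := by
    decide +kernel
  exact hall _ _ _ _ _ _ _ _ ha t v

theorem card_next_eq_offset {a : Surroundings} (ha : a.IsAmbiguous) (t : ZMod 2) :
    (Finset.univ.filter fun v => a.next t v = offset v).card = if ¬a.IsOpposite then 1 else 0 := by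
  have hall : ∀ n e s w nw ne sw se : ZMod 2, IsAmbiguous ⟨n, e, s, w, nw, ne, sw, se⟩ →
      ∀ t, (Finset.univ.filter fun v => next ⟨n, e, s, w, nw, ne, sw, se⟩ t v = offset v).card =
        if ¬n = s then 1 else 0 := by
    decide +kernel
  exact hall _ _ _ _ _ _ _ _ ha t

end Surroundings

theorem next_add_offset (g : ℤ → ℤ → ZMod 2) (x y : ℤ) (v : Bool × Bool) :
    next g ((x, y) + offset v) = (x, y) + (surroundings g x y).next (g x y) v := by
  obtain ⟨_ | _, _ | _⟩ := v <;> simp [next, offset, surroundings, Surroundings.next, ← add_assoc]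

theorem NoCheckerboard.around {g : ℤ → ℤ → ZMod 2} (hg : NoCheckerboard g) (x y : ℤ) :
    ¬IsCheckerboard (g x y) (g (x - 1) y) (g (x - 1) (y - 1)) (g x (y - 1)) ∧
    ¬IsCheckerboard (g (x + 1) y) (g x y) (g x (y - 1)) (g (x + 1) (y - 1)) ∧
    ¬IsCheckerboard (g x (y + 1)) (g (x - 1) (y + 1)) (g (x - 1) y) (g x y) ∧
    ¬IsCheckerboard (g (x + 1) (y + 1)) (g x (y + 1)) (g x y) (g (x + 1) y) := by
  have hse := hg (x + 1) y
  have hnw := hg x (y + 1)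
  have hne := hg (x + 1) (y + 1)
  simp only [add_sub_cancel_right] at hse hnw hne
  exact ⟨hg x y, hse, hnw, hne⟩

theorem IsInterior.cellSum_eq_val {m n : ℕ} {C : lattice.Subgraph} {g : ℤ → ℤ → ZMod 2}
    (h : IsInterior m n C g) (x y : ℤ) :
    cellSum (R := ℤ) (indicator C.edgeSet 1) x y = ((g x (y + 1) + g x y).val +
      (g (x + 1) y + g x y).val + (g x (y - 1) + g x y).val + (g (x - 1) y + g x y).val : ℕ) := by
  have hval {a b : ZMod 2} {e : Sym2 (ℤ × ℤ)} (he : a + b = indicator C.edgeSet 1 e) :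
      indicator C.edgeSet (1 : Sym2 (ℤ × ℤ) → ℤ) e = (a + b).val := by
    rw [he]
    by_cases hmem : e ∈ C.edgeSet <;> simp [hmem, ZMod.val_one]
  have hupper := h.horiz x (y + 1)
  have hright := h.vert (x + 1) y
  rw [add_sub_cancel_right, add_comm] at hupper hright
  rw [cellSum, hval (h.horiz x y), hval (h.vert x y), hval hupper, hval hright]
  push_cast
  ring

/-- Two cycles of the same signature, the interiors of which differ by the cells with two odd
coordinates, in a grid with even dimensions. -/
structure IsOddCellPair (P Q : ℕ) (C₁ C₂ : lattice.Subgraph) (g₁ g₂ : ℤ → ℤ → ZMod 2) : Prop where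
  cycle₁ : IsGridCycle (2 * P) (2 * Q) C₁
  cycle₂ : IsGridCycle (2 * P) (2 * Q) C₂
  interior₁ : IsInterior (2 * P) (2 * Q) C₁ g₁
  interior₂ : IsInterior (2 * P) (2 * Q) C₂ g₂
  signature_eq : signature (2 * P) (2 * Q) C₁ = signature (2 * P) (2 * Q) C₂
  add_eq : ∀ x y, (x, y) ∈ cells (2 * P) (2 * Q) →
    g₁ x y + g₂ x y = if x % 2 = 1 ∧ y % 2 = 1 then 1 else 0

/-- The lower left vertex of the odd cell with the given numbers. -/
def oddCorner {P Q : ℕ} (S : Fin P × Fin Q) : ℤ × ℤ := (2 * S.1 + 1, 2 * S.2 + 1)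

theorem oddCorner_fst_emod_two {P Q : ℕ} (S : Fin P × Fin Q) : (oddCorner S).1 % 2 = 1 := by
  rw [oddCorner]; omega

theorem oddCorner_snd_emod_two {P Q : ℕ} (S : Fin P × Fin Q) : (oddCorner S).2 % 2 = 1 := by
  rw [oddCorner]; omega

theorem oddCorner_mem_cells {P Q : ℕ} (S : Fin P × Fin Q) :
    ((oddCorner S).1, (oddCorner S).2) ∈ cells (2 * P) (2 * Q) := by
  simp only [mem_cells, oddCorner]
  omega

/-- The surroundings of the odd cell with the given numbers. -/
def oddSurroundings {P Q : ℕ} (g : ℤ → ℤ → ZMod 2) (S : Fin P × Fin Q) : Surroundings :=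
  surroundings g (oddCorner S).1 (oddCorner S).2

theorem next_oddCorner_add_offset {P Q : ℕ} (g : ℤ → ℤ → ZMod 2) (S : Fin P × Fin Q)
    (v : Bool × Bool) : next g (oddCorner S + offset v) =
      oddCorner S + (oddSurroundings g S).next (g (oddCorner S).1 (oddCorner S).2) v :=
  next_add_offset g _ _ v

/-- The vertices of the `2P × 2Q` grid are the vertices of its odd cells. -/
def oddCellEquiv (P Q : ℕ) :
    (Fin P × Fin Q) × (Bool × Bool) ≃ (grid (2 * P) (2 * Q)).verts where
  toFun v := ⟨oddCorner v.1 + offset v.2, by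
    obtain ⟨⟨⟨i, hi⟩, ⟨j, hj⟩⟩, ⟨_ | _, _ | _⟩⟩ := v <;>
      simp [oddCorner, offset, mem_verts_grid] <;> omega⟩
  invFun p := ((⟨((p.1.1 - 1) / 2).toNat, by have := mem_verts_grid.1 p.2; omega⟩,
    ⟨((p.1.2 - 1) / 2).toNat, by have := mem_verts_grid.1 p.2; omega⟩),
    (decide (p.1.1 % 2 = 0), decide (p.1.2 % 2 = 0)))
  left_inv v := by
    obtain ⟨⟨⟨i, hi⟩, ⟨j, hj⟩⟩, ⟨_ | _, _ | _⟩⟩ := v <;> simp [oddCorner, offset] <;> omega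
  right_inv p := by
    obtain ⟨⟨x, y⟩, hx, hx', hy, hy'⟩ := p
    dsimp only at hx hx' hy hy'
    apply Subtype.ext
    rcases Int.emod_two_eq_zero_or_one x with hx2 | hx2 <;>
      rcases Int.emod_two_eq_zero_or_one y with hy2 | hy2 <;>
        simp [oddCorner, offset, hx2, hy2] <;> omega

namespace IsOddCellPair

variable {P Q : ℕ} {C₁ C₂ : lattice.Subgraph} {g₁ g₂ : ℤ → ℤ → ZMod 2}
  (h : IsOddCellPair P Q C₁ C₂ g₁ g₂)

include h

theorem eq_of_not_odd {x y : ℤ} (hxy : ¬(x % 2 = 1 ∧ y % 2 = 1)) : g₁ x y = g₂ x y := by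
  by_cases hcell : (x, y) ∈ cells (2 * P) (2 * Q)
  · rw [← CharTwo.add_eq_zero, h.add_eq x y hcell, if_neg hxy]
  · rw [h.interior₁.outside x y hcell, h.interior₂.outside x y hcell]

theorem eq_add_one_of_odd {x y : ℤ} (hcell : (x, y) ∈ cells (2 * P) (2 * Q))
    (hx : x % 2 = 1) (hy : y % 2 = 1) : g₂ x y = g₁ x y + 1 := by
  have hadd := h.add_eq x y hcell
  rw [if_pos ⟨hx, hy⟩] at hadd
  rw [← hadd, CharTwo.add_cancel_left]

theorem surroundings_eq {x y : ℤ} (hx : x % 2 = 1) (hy : y % 2 = 1) :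
    surroundings g₂ x y = surroundings g₁ x y := by
  rw [surroundings, ← h.eq_of_not_odd (by omega), ← h.eq_of_not_odd (by omega),
    ← h.eq_of_not_odd (by omega), ← h.eq_of_not_odd (by omega), ← h.eq_of_not_odd (by omega),
    ← h.eq_of_not_odd (by omega), ← h.eq_of_not_odd (by omega), ← h.eq_of_not_odd (by omega),
    surroundings]

theorem isAmbiguous {x y : ℤ} (hcell : (x, y) ∈ cells (2 * P) (2 * Q))
    (hx : x % 2 = 1) (hy : y % 2 = 1) : (surroundings g₁ x y).IsAmbiguous := by
  have hsurr := h.surroundings_eq hx hy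
  have hflip := h.eq_add_one_of_odd hcell hx hy
  constructor
  · have hcount : ∀ n e s w t : ZMod 2,
        (n + t).val + (e + t).val + (s + t).val + (w + t).val =
          (n + (t + 1)).val + (e + (t + 1)).val + (s + (t + 1)).val + (w + (t + 1)).val →
        n.val + e.val + s.val + w.val = 2 := by decide
    have hsum := cellSum_eq_of_signature_eq h.signature_eq ℤ hcell
    rw [h.interior₁.cellSum_eq_val, h.interior₂.cellSum_eq_val, Nat.cast_inj, hflip,
      ← h.eq_of_not_odd (y := y + 1) (by omega), ← h.eq_of_not_odd (x := x + 1) (by omega),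
      ← h.eq_of_not_odd (y := y - 1) (by omega), ← h.eq_of_not_odd (x := x - 1) (by omega)] at hsum
    exact hcount _ _ _ _ _ hsum
  · intro t
    have ht : ∀ a : ZMod 2, t = a ∨ t = a + 1 := by revert t; decide
    rcases ht (g₁ x y) with rfl | rfl
    · exact (h.interior₁.noCheckerboard h.cycle₁).around x y
    · rw [← hsurr, ← hflip]
      exact (h.interior₂.noCheckerboard h.cycle₂).around x y

theorem one_lt (hP : 0 < P) (hQ : 0 < Q) : 1 < P ∧ 1 < Q := by
  have hcount := (h.isAmbiguous (x := 1) (y := 1) (by rw [mem_cells]; omega) rfl rfl).1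
  have hlt (x y : ℤ) : (g₁ x y).val < 2 := ZMod.val_lt _
  have hout {x y : ℤ} (hxy : (x, y) ∉ cells (2 * P) (2 * Q)) : (g₁ x y).val = 0 := by
    rw [h.interior₁.outside x y hxy, ZMod.val_zero]
  have hs := hout (x := 1) (y := 1 - 1) (by rw [mem_cells]; omega)
  have hw := hout (x := 1 - 1) (y := 1) (by rw [mem_cells]; omega)
  have hn := hlt 1 (1 + 1)
  have he := hlt (1 + 1) 1
  dsimp only [surroundings] at hcount
  constructor <;> by_contra hle
  · have he' := hout (x := 1 + 1) (y := 1) (by rw [mem_cells]; omega)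
    omega
  · have hn' := hout (x := 1) (y := 1 + 1) (by rw [mem_cells]; omega)
    omega

theorem isAmbiguous_oddSurroundings (S : Fin P × Fin Q) :
    (oddSurroundings g₁ S).IsAmbiguous :=
  h.isAmbiguous (oddCorner_mem_cells S) (oddCorner_fst_emod_two S) (oddCorner_snd_emod_two S)

theorem gridPerm_eq_mul : h.interior₁.gridPerm h.cycle₁ = h.interior₂.gridPerm h.cycle₂ *
    (oddCellEquiv P Q).permCongr (Equiv.prodCongrRight fun S =>
      (oddSurroundings g₁ S).squarePerm (g₁ (oddCorner S).1 (oddCorner S).2)) := by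
  ext1 p
  obtain ⟨⟨S, v⟩, rfl⟩ := (oddCellEquiv P Q).surjective p
  have hfst := oddCorner_fst_emod_two S
  have hsnd := oddCorner_snd_emod_two S
  apply Subtype.ext
  rw [Equiv.Perm.mul_apply, Equiv.permCongr_apply, Equiv.symm_apply_apply,
    IsInterior.coe_gridPerm, IsInterior.coe_gridPerm]
  change next g₁ (oddCorner S + offset v) = next g₂ (oddCorner S + offset
    ((oddSurroundings g₁ S).squarePerm (g₁ (oddCorner S).1 (oddCorner S).2) v))
  have hsurroundings : oddSurroundings g₂ S = oddSurroundings g₁ S := h.surroundings_eq hfst hsnd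
  rw [next_oddCorner_add_offset, next_oddCorner_add_offset, hsurroundings,
    h.eq_add_one_of_odd (oddCorner_mem_cells S) hfst hsnd,
    Surroundings.next_squarePerm (h.isAmbiguous_oddSurroundings S)]

theorem even_card_isOpposite :
    Even (Finset.univ.filter fun S : Fin P × Fin Q => (oddSurroundings g₁ S).IsOpposite).card := by
  classical
  let _ := Fintype.ofEquiv _ (oddCellEquiv P Q)
  have hsign := congrArg Equiv.Perm.sign h.gridPerm_eq_mul
  rw [Equiv.Perm.sign_mul, Equiv.Perm.sign_permCongr, Equiv.Perm.sign_prodCongrRight,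
    (h.interior₁.isCycle_gridPerm h.cycle₁).sign, (h.interior₂.isCycle_gridPerm h.cycle₂).sign,
    (h.interior₁.even_card_support_gridPerm h.cycle₁).neg_one_pow,
    (h.interior₂.even_card_support_gridPerm h.cycle₂).neg_one_pow] at hsign
  simp only [Surroundings.sign_squarePerm] at hsign
  rwa [Finset.prod_ite, Finset.prod_const_one, mul_one, Finset.prod_const, left_eq_mul,
    neg_one_pow_eq_one_iff_even (by decide)] at hsign

theorem card_fixed_eq_card_not_isOpposite :
    (Finset.univ.filter fun v => h.interior₁.gridPerm h.cycle₁ (oddCellEquiv P Q v) =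
      oddCellEquiv P Q v).card =
    (Finset.univ.filter fun S : Fin P × Fin Q => ¬(oddSurroundings g₁ S).IsOpposite).card := by
  rw [Finset.card_filter, Fintype.sum_prod_type, Finset.card_filter]
  refine Finset.sum_congr rfl fun S _ => ?_
  rw [← Finset.card_filter, ← Surroundings.card_next_eq_offset (h.isAmbiguous_oddSurroundings S)
    (g₁ (oddCorner S).1 (oddCorner S).2)]
  congr 1
  refine Finset.filter_congr fun v _ => ?_
  rw [Subtype.ext_iff]
  change next g₁ (oddCorner S + offset v) = oddCorner S + offset v ↔ _
  rw [next_oddCorner_add_offset]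
  exact add_right_inj _

theorem even_card_not_isOpposite : Even (Finset.univ.filter fun S : Fin P × Fin Q =>
    ¬(oddSurroundings g₁ S).IsOpposite).card := by
  classical
  let _ := Fintype.ofEquiv _ (oddCellEquiv P Q)
  have hsupport : (Finset.univ.filter fun v => ¬h.interior₁.gridPerm h.cycle₁
      (oddCellEquiv P Q v) = oddCellEquiv P Q v).card =
        (h.interior₁.gridPerm h.cycle₁).support.card :=
    Finset.card_equiv (oddCellEquiv P Q) fun v => by simp
  have heven := h.interior₁.even_card_support_gridPerm h.cycle₁
  have htotal := Finset.card_filter_add_card_filter_not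
    (s := (Finset.univ : Finset ((Fin P × Fin Q) × (Bool × Bool))))
    fun v => h.interior₁.gridPerm h.cycle₁ (oddCellEquiv P Q v) = oddCellEquiv P Q v
  rw [h.card_fixed_eq_card_not_isOpposite, hsupport] at htotal
  simp only [Finset.card_univ, Fintype.card_prod, Fintype.card_fin, Fintype.card_bool] at htotal
  rw [Nat.even_iff] at heven ⊢
  omega

theorem even_mul : Even (P * Q) := by
  have htotal := Finset.card_filter_add_card_filter_not
    (s := (Finset.univ : Finset (Fin P × Fin Q))) fun S => (oddSurroundings g₁ S).IsOpposite
  rw [Finset.card_univ, Fintype.card_prod, Fintype.card_fin, Fintype.card_fin] at htotal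
  rw [← htotal]
  exact h.even_card_isOpposite.add h.even_card_not_isOpposite

end IsOddCellPair

theorem IsInterior.isCellWave_add {m n : ℕ} {C₁ C₂ : lattice.Subgraph} {g₁ g₂ : ℤ → ℤ → ZMod 2}
    (h₁ : IsInterior m n C₁ g₁) (h₂ : IsInterior m n C₂ g₂)
    (hsig : signature m n C₁ = signature m n C₂) : IsCellWave m n (g₁ + g₂) where
  wave x y hxy := by
    have hsum := cellSum_eq_of_signature_eq hsig (ZMod 2) hxy
    rw [h₁.cellSum_eq, h₂.cellSum_eq, ← CharTwo.add_eq_zero] at hsum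
    rw [← CharTwo.add_eq_zero, ← hsum]
    simp only [Pi.add_apply]
    abel
  outside x y hxy := by
    rw [Pi.add_apply, Pi.add_apply, h₁.outside x y hxy, h₂.outside x y hxy, add_zero]

section SignatureEq

variable {m n : ℕ} {C₁ C₂ : lattice.Subgraph}

theorem rayParity_add_ne_zero (hC₁ : IsGridCycle m n C₁) (hC₂ : IsGridCycle m n C₂)
    (hne : C₁ ≠ C₂) : rayParity m C₁ + rayParity m C₂ ≠ 0 := fun hzero =>
  have hinterior : rayParity m C₁ = rayParity m C₂ := by
    funext x y
    exact CharTwo.add_eq_zero.1 (congrFun (congrFun hzero x) y)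
  hne <| hC₁.eq_of_edgeSet_eq hC₂ <|
    hC₁.isInterior_rayParity.edgeSet_eq (hinterior ▸ hC₂.isInterior_rayParity)

theorem gcd_ne_one_of_signature_eq (hC₁ : IsGridCycle m n C₁) (hC₂ : IsGridCycle m n C₂)
    (hne : C₁ ≠ C₂) (hsig : signature m n C₁ = signature m n C₂) (hm : 0 < m) (hn : 0 < n) :
    Nat.gcd m n ≠ 1 := fun hd =>
  rayParity_add_ne_zero hC₁ hC₂ hne <| by
    funext x y
    exact (hC₁.isInterior_rayParity.isCellWave_add hC₂.isInterior_rayParity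
      hsig).eq_zero_of_gcd_eq_one hm hn hd x y

theorem isOddCellPair_of_gcd_eq_two {P Q : ℕ}
    (hC₁ : IsGridCycle (2 * P) (2 * Q) C₁) (hC₂ : IsGridCycle (2 * P) (2 * Q) C₂) (hne : C₁ ≠ C₂)
    (hsig : signature (2 * P) (2 * Q) C₁ = signature (2 * P) (2 * Q) C₂) (hP : 0 < P)
    (hQ : 0 < Q) (hd : Nat.gcd (2 * P) (2 * Q) = 2) :
    IsOddCellPair P Q C₁ C₂ (rayParity (2 * P) C₁) (rayParity (2 * P) C₂) := by
  have hwave := hC₁.isInterior_rayParity.isCellWave_add hC₂.isInterior_rayParity hsig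
  have hodd {x y : ℤ} := hwave.eq_ite_of_gcd_eq_two (x := x) (y := y) (by omega) (by omega) hd
  refine ⟨hC₁, hC₂, hC₁.isInterior_rayParity, hC₂.isInterior_rayParity, hsig, ?_⟩
  have hbit : ∀ a : ZMod 2, a = 0 ∨ a = 1 := by decide
  rcases hbit ((rayParity (2 * P) C₁ + rayParity (2 * P) C₂) 1 1) with hcorner | hcorner
  · refine absurd ?_ (rayParity_add_ne_zero hC₁ hC₂ hne)
    funext x y
    by_cases hxy : (x, y) ∈ cells (2 * P) (2 * Q)
    · rw [hodd hxy, hcorner, ite_self, Pi.zero_apply, Pi.zero_apply]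
    · exact hwave.outside x y hxy
  · intro x y hxy
    rw [← hcorner]
    exact hodd hxy

theorem dimensions_of_signature_eq (hC₁ : IsGridCycle m n C₁) (hC₂ : IsGridCycle m n C₂)
    (hne : C₁ ≠ C₂) (hsig : signature m n C₁ = signature m n C₂) (hm : 0 < m) (hn : 0 < n) :
    (3 ≤ m ∧ 3 ≤ n) ∧ 2 ≤ Nat.gcd m n ∧ (Nat.gcd m n = 2 → m ≡ 0 [MOD 4] ∨ n ≡ 0 [MOD 4]) := by
  have hone := gcd_ne_one_of_signature_eq hC₁ hC₂ hne hsig hm hn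
  have hpos := Nat.gcd_pos_of_pos_left n hm
  have hle₁ := Nat.gcd_le_left n hm
  have hle₂ := Nat.gcd_le_right m hn
  rcases eq_or_ne (Nat.gcd m n) 2 with hd | hd
  · obtain ⟨P, rfl⟩ : 2 ∣ m := hd ▸ Nat.gcd_dvd_left m n
    obtain ⟨Q, rfl⟩ : 2 ∣ n := hd ▸ Nat.gcd_dvd_right (2 * P) n
    have hpair := isOddCellPair_of_gcd_eq_two hC₁ hC₂ hne hsig (by omega) (by omega) hd
    have hlt := hpair.one_lt (by omega) (by omega)
    have heven := Nat.even_mul.1 hpair.even_mul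
    simp only [Nat.even_iff, Nat.ModEq] at heven ⊢
    omega
  · omega

end SignatureEq

open SimpleGraph

/-! ### Merging cycles and rerouting them around a square -/

section EdgeSets

variable {V : Type*} {E F E₁ E₂ F₁ F₂ : Set (Sym2 V)} {a b c d : V}

/-- The vertices covered by a set of edges. -/
def endpoints (E : Set (Sym2 V)) : Set V := {v | ∃ e ∈ E, v ∈ e}

theorem left_mem_endpoints (h : s(a, b) ∈ E) : a ∈ endpoints E := ⟨_, h, Sym2.mem_mk_left a b⟩

theorem right_mem_endpoints (h : s(a, b) ∈ E) : b ∈ endpoints E := ⟨_, h, Sym2.mem_mk_right a b⟩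

theorem endpoints_preimage_map {W : Type*} (φ : V ≃ W) (E : Set (Sym2 W)) :
    endpoints (Sym2.map φ ⁻¹' E) = φ ⁻¹' endpoints E := by
  ext v
  refine ⟨fun ⟨e, he, hv⟩ => ⟨_, he, Sym2.mem_map.2 ⟨v, hv, rfl⟩⟩, fun ⟨e, he, hv⟩ =>
    ⟨Sym2.map φ.symm e, ?_, Sym2.mem_map.2 ⟨φ v, hv, φ.symm_apply_apply v⟩⟩⟩
  rw [Set.mem_preimage, Sym2.map_map, φ.self_comp_symm, Sym2.map_id, id]
  exact he

theorem disjoint_of_disjoint_endpoints (h : Disjoint (endpoints E) (endpoints F)) :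
    Disjoint E F := by
  refine Set.disjoint_left.2 fun e => ?_
  induction e using Sym2.ind with
  | _ a b =>
    exact fun hE hF => Set.disjoint_left.1 h (left_mem_endpoints hE) (left_mem_endpoints hF)

/-- The edge set obtained from `E` and `F` by replacing the edges `ab` of `E` and `cd` of `F` by the
edges `ac` and `bd`. -/
def merge (E F : Set (Sym2 V)) (a b c d : V) : Set (Sym2 V) :=
  ((E ∪ F) \ {s(a, b), s(c, d)}) ∪ {s(a, c), s(b, d)}

/-- The edge set obtained from `E` by replacing its edge `ab` by the edges `ac`, `cd` and `db`. -/
def detour (E : Set (Sym2 V)) (a b c d : V) : Set (Sym2 V) :=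
  (E \ {s(a, b)}) ∪ {s(a, c), s(c, d), s(b, d)}

theorem endpoints_merge_subset (hab : s(a, b) ∈ E) (hcd : s(c, d) ∈ F) :
    endpoints (merge E F a b c d) ⊆ endpoints E ∪ endpoints F := by
  rintro v ⟨e, ⟨he | he, -⟩ | rfl | rfl, hv⟩
  · exact .inl ⟨e, he, hv⟩
  · exact .inr ⟨e, he, hv⟩
  all_goals rcases Sym2.mem_iff.1 hv with rfl | rfl
  exacts [.inl (left_mem_endpoints hab), .inr (left_mem_endpoints hcd),
    .inl (right_mem_endpoints hab), .inr (right_mem_endpoints hcd)]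

theorem endpoints_detour_subset (hab : s(a, b) ∈ E) :
    endpoints (detour E a b c d) ⊆ endpoints E ∪ {c, d} := by
  rintro v ⟨e, ⟨he, -⟩ | rfl | rfl | rfl, hv⟩
  · exact .inl ⟨e, he, hv⟩
  all_goals rcases Sym2.mem_iff.1 hv with rfl | rfl
  exacts [.inl (left_mem_endpoints hab), .inr (.inl rfl), .inr (.inl rfl), .inr (.inr rfl),
    .inl (right_mem_endpoints hab), .inr (.inr rfl)]

/-- The difference of the indicator functions of two edge sets. -/
noncomputable def edgeDiff (E₁ E₂ : Set (Sym2 V)) : Sym2 V → ℤ :=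
  indicator E₁ 1 - indicator E₂ 1

theorem edgeDiff_swap (E₁ E₂ : Set (Sym2 V)) : edgeDiff E₂ E₁ = -edgeDiff E₁ E₂ :=
  (neg_sub _ _).symm

theorem indicator_sdiff_union {α M : Type*} [AddCommGroup M] {S A B : Set α} (hA : A ⊆ S)
    (hB : Disjoint S B) (f : α → M) :
    indicator ((S \ A) ∪ B) f = indicator S f - indicator A f + indicator B f := by
  rw [Set.indicator_union_of_disjoint (hB.mono_left Set.sdiff_subset), Set.indicator_sdiff hA]
  rfl

theorem indicator_merge (h : Disjoint (endpoints E) (endpoints F)) (hab : s(a, b) ∈ E)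
    (hcd : s(c, d) ∈ F) : indicator (merge E F a b c d) (1 : Sym2 V → ℤ) =
      indicator E 1 + indicator F 1 - indicator {s(a, b), s(c, d)} 1 +
        indicator {s(a, c), s(b, d)} 1 := by
  have ha := Set.disjoint_left.1 h (left_mem_endpoints hab)
  have hb := Set.disjoint_left.1 h (right_mem_endpoints hab)
  have hc := Set.disjoint_right.1 h (left_mem_endpoints hcd)
  have hd := Set.disjoint_right.1 h (right_mem_endpoints hcd)
  rw [merge, indicator_sdiff_union,
    Set.indicator_union_of_disjoint (disjoint_of_disjoint_endpoints h)]
  · rfl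
  · exact Set.insert_subset (.inl hab) (Set.singleton_subset_iff.2 (.inr hcd))
  · refine Set.disjoint_right.2 ?_
    rintro e (rfl | rfl) (he | he)
    exacts [hc (right_mem_endpoints he), ha (left_mem_endpoints he), hd (right_mem_endpoints he),
      hb (left_mem_endpoints he)]

theorem indicator_detour (hab : s(a, b) ∈ E) (hc : c ∉ endpoints E) (hd : d ∉ endpoints E) :
    indicator (detour E a b c d) (1 : Sym2 V → ℤ) =
      indicator E 1 - indicator {s(a, b)} 1 + indicator {s(a, c), s(c, d), s(b, d)} 1 := by
  rw [detour, indicator_sdiff_union (Set.singleton_subset_iff.2 hab)]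
  refine Set.disjoint_right.2 ?_
  rintro e (rfl | rfl | rfl) he
  exacts [hc (right_mem_endpoints he), hc (left_mem_endpoints he), hd (right_mem_endpoints he)]

theorem edgeDiff_merge (h₁ : Disjoint (endpoints E₁) (endpoints F₁))
    (h₂ : Disjoint (endpoints E₂) (endpoints F₂)) (hab₁ : s(a, b) ∈ E₁) (hab₂ : s(a, b) ∈ E₂)
    (hcd₁ : s(c, d) ∈ F₁) (hcd₂ : s(c, d) ∈ F₂) :
    edgeDiff (merge E₁ F₁ a b c d) (merge E₂ F₂ a b c d) =
      edgeDiff E₁ E₂ + edgeDiff F₁ F₂ := by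
  rw [edgeDiff, indicator_merge h₁ hab₁ hcd₁, indicator_merge h₂ hab₂ hcd₂, edgeDiff, edgeDiff]
  abel

theorem edgeDiff_detour (hab₁ : s(a, b) ∈ E₁) (hab₂ : s(a, b) ∈ E₂) (hc₁ : c ∉ endpoints E₁)
    (hc₂ : c ∉ endpoints E₂) (hd₁ : d ∉ endpoints E₁) (hd₂ : d ∉ endpoints E₂) :
    edgeDiff (detour E₁ a b c d) (detour E₂ a b c d) = edgeDiff E₁ E₂ := by
  rw [edgeDiff, indicator_detour hab₁ hc₁ hd₁, indicator_detour hab₂ hc₂ hd₂, edgeDiff]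
  abel

end EdgeSets

section Cycles

variable {V : Type*} {G : SimpleGraph V} {E F : Set (Sym2 V)} {a b c d : V}

/-- `E` is the edge set of a cycle of `G`. -/
def IsCycleSet (G : SimpleGraph V) (E : Set (Sym2 V)) : Prop :=
  ∃ (v : V) (w : G.Walk v v), w.IsCycle ∧ w.edgeSet = E

theorem exists_isCycle_cons (hE : IsCycleSet G E) (hab : s(a, b) ∈ E) :
    ∃ (h : G.Adj a b) (p : G.Walk b a),
      (Walk.cons h p).IsCycle ∧ (Walk.cons h p).edgeSet = E := by
  classical
  obtain ⟨v, w, hw, rfl⟩ := hE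
  have ha : a ∈ w.support := w.fst_mem_support_of_mem_edges hab
  have hrot : (w.rotate a ha).edgeSet = w.edgeSet := Set.ext fun _ =>
    (w.rotate_edges a ha).mem_iff
  rw [← hrot] at hab ⊢
  have hcycle := hw.rotate ha
  generalize w.rotate a ha = r at hab hcycle
  -- A cycle starting at `a` uses the edge `ab` either at its first or at its last step.
  by_cases hsnd : r.snd = b
  · cases r with
    | nil => exact absurd hcycle (by simp)
    | cons h p =>
      rw [Walk.snd_cons] at hsnd
      subst hsnd
      exact ⟨h, p, hcycle, rfl⟩
  · have hlast : r.reverse.snd = b := by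
      cases r with
      | nil => exact absurd hcycle (by simp)
      | cons h p =>
        have hp : s(a, b) ∈ p.edges := by
          rcases List.mem_cons.1 (Walk.mem_edgeSet.1 hab) with hfirst | hp
          · exact (hsnd ((p.snd_cons h).trans (Sym2.congr_right.1 hfirst).symm)).elim
          · exact hp
        rw [Walk.snd_reverse,
          Walk.penultimate_cons_of_not_nil _ _ (Walk.not_nil_of_isCycle_cons hcycle)]
        exact (((Walk.cons_isCycle_iff p h).1 hcycle).1.eq_penultimate_of_mem_edges hp).symm
    have hrev := hcycle.reverse
    rw [← r.edgeSet_reverse]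
    generalize r.reverse = r' at hlast hrev
    cases r' with
    | nil => exact absurd hrev (by simp)
    | cons h p =>
      rw [Walk.snd_cons] at hlast
      subst hlast
      exact ⟨h, p, hrev, rfl⟩

namespace IsCycleSet

theorem exists_path (hE : IsCycleSet G E) (hab : s(a, b) ∈ E) :
    ∃ p : G.Walk b a, p.IsPath ∧ p.edgeSet = E \ {s(a, b)} ∧ ∀ v ∈ p.support, v ∈ endpoints E := by
  obtain ⟨h, p, hcycle, rfl⟩ := exists_isCycle_cons hE hab
  rw [Walk.cons_isCycle_iff] at hcycle
  refine ⟨p, hcycle.1, ?_, fun v hv => ?_⟩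
  · rw [Walk.edgeSet_cons, Set.insert_sdiff_self_of_notMem (show s(a, b) ∉ p.edgeSet from hcycle.2)]
  · rcases Walk.mem_support_iff_exists_mem_edges.1 hv with rfl | ⟨e, he, hv⟩
    · exact left_mem_endpoints hab
    · exact ⟨e, List.mem_cons_of_mem _ he, hv⟩

theorem reroute (hE : IsCycleSet G E) (hab : s(a, b) ∈ E) (hac : G.Adj a c) (hbd : G.Adj b d)
    {q : G.Walk c d} (hq : q.IsPath) (hqE : ∀ v ∈ q.support, v ∉ endpoints E) :
    IsCycleSet G ((E \ {s(a, b)}) ∪ ({s(a, c), s(b, d)} ∪ q.edgeSet)) := by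
  obtain ⟨hadj, -⟩ := exists_isCycle_cons hE hab
  obtain ⟨p, hp, hpE, hsupp⟩ := hE.exists_path hab
  have hcE : c ∉ endpoints E := hqE c q.start_mem_support
  refine ⟨a, .cons hac (q.append (.cons hbd.symm p)), ?_, ?_⟩
  · rw [Walk.cons_isCycle_iff, Walk.isPath_def, Walk.support_append]
    refine ⟨List.nodup_append'.2 ⟨hq.support_nodup, hp.support_nodup,
      fun v hvq hvp => hqE v hvq (hsupp v hvp)⟩, fun hmem => ?_⟩
    rw [Walk.edges_append, Walk.edges_cons, List.mem_append, List.mem_cons] at hmem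
    rcases hmem with hmem | hmem | hmem
    · exact hqE a (q.fst_mem_support_of_mem_edges hmem) (left_mem_endpoints hab)
    · rcases Sym2.eq_iff.1 hmem with ⟨-, rfl⟩ | ⟨rfl, -⟩
      · exact hcE (right_mem_endpoints hab)
      · exact hadj.ne rfl
    · exact hcE (hsupp c (p.snd_mem_support_of_mem_edges hmem))
  · rw [Walk.edgeSet_cons, Walk.edgeSet_append, Walk.edgeSet_cons, hpE, Sym2.eq_swap (a := d)]
    ext e
    simp only [Set.mem_union, Set.mem_insert_iff, Set.mem_singleton_iff]
    tauto

theorem merge (hE : IsCycleSet G E) (hF : IsCycleSet G F)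
    (hEF : Disjoint (endpoints E) (endpoints F)) (hab : s(a, b) ∈ E) (hcd : s(c, d) ∈ F)
    (hac : G.Adj a c) (hbd : G.Adj b d) : IsCycleSet G (merge E F a b c d) := by
  obtain ⟨q, hq, hqF, hsupp⟩ := hF.exists_path (Sym2.eq_swap ▸ hcd : s(d, c) ∈ F)
  convert hE.reroute hab hac hbd hq fun v hv => Set.disjoint_right.1 hEF (hsupp v hv) using 1
  have hEF' := disjoint_of_disjoint_endpoints hEF
  rw [hqF, Sym2.eq_swap (a := d), Slitherlink.merge, Set.union_sdiff_distrib, Set.insert_eq,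
    ← Set.sdiff_sdiff, ← Set.sdiff_sdiff,
    Set.sdiff_singleton_eq_self fun h => Set.disjoint_left.1 hEF' h.1 hcd,
    Set.sdiff_singleton_eq_self (a := s(a, b)) (s := F) (Set.disjoint_left.1 hEF' hab),
    Set.union_assoc, Set.union_comm (F \ _), Set.insert_eq]

theorem detour (hE : IsCycleSet G E) (hab : s(a, b) ∈ E) (hc : c ∉ endpoints E)
    (hd : d ∉ endpoints E) (hac : G.Adj a c) (hcd : G.Adj c d) (hbd : G.Adj b d) :
    IsCycleSet G (detour E a b c d) := by
  convert hE.reroute (q := .cons hcd .nil) hab hac hbd (by simp [hcd.ne]) (by simp [hc, hd]) using 1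
  ext e
  simp only [Slitherlink.detour, Walk.edgeSet_cons, Walk.edgeSet_nil, Set.mem_union,
    Set.mem_insert_iff, Set.mem_singleton_iff, Set.mem_empty_iff_false, or_false]
  tauto

theorem preimage_map {W : Type*} {H : SimpleGraph W} {E : Set (Sym2 W)} (hE : IsCycleSet H E)
    (φ : G ≃g H) : IsCycleSet G (Sym2.map φ ⁻¹' E) := by
  obtain ⟨v, w, hw, rfl⟩ := hE
  refine ⟨_, w.map φ.symm.toHom,
    (Walk.isCycle_map_iff_of_injective φ.symm.injective).2 hw, ?_⟩
  rw [Walk.edgeSet_map, Set.image_eq_preimage_of_inverse (g := Sym2.map φ)]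
  all_goals intro e; induction e using Sym2.ind; simp

end IsCycleSet

end Cycles

/-! ### Gluing tiles -/

theorem lattice_adj_right (x y : ℤ) : lattice.Adj (x, y) (x + 1, y) := by simp [lattice]

theorem lattice_adj_up (x y : ℤ) : lattice.Adj (x, y) (x, y + 1) := by simp [lattice]

theorem hEdge_inj {x y x' y' : ℤ} : hEdge x y = hEdge x' y' ↔ x = x' ∧ y = y' := by
  simp only [hEdge, Sym2.eq_iff, Prod.mk.injEq]
  omega

theorem vEdge_inj {x y x' y' : ℤ} : vEdge x y = vEdge x' y' ↔ x = x' ∧ y = y' := by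
  simp only [vEdge, Sym2.eq_iff, Prod.mk.injEq]
  omega

theorem hEdge_ne_vEdge {x y x' y' : ℤ} : hEdge x y ≠ vEdge x' y' := by
  simp only [hEdge, vEdge, ne_eq, Sym2.eq_iff, Prod.mk.injEq]
  omega

section Symmetries

/-- The translation of the lattice by `(-k, -l)`. -/
def shiftIso (k l : ℤ) : lattice ≃g lattice where
  toEquiv := (Equiv.subRight k).prodCongr (Equiv.subRight l)
  map_rel_iff' := by simp [lattice]; omega

/-- The reflection of the lattice which exchanges the two vertical sides of a grid of width `m`. -/
def mirrorIso (m : ℤ) : lattice ≃g lattice where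
  toEquiv := (Equiv.subLeft (m + 1)).prodCongr (Equiv.refl ℤ)
  map_rel_iff' := by simp [lattice]; omega

/-- The reflection of the lattice in the diagonal. -/
def swapIso : lattice ≃g lattice where
  toEquiv := Equiv.prodComm ℤ ℤ
  map_rel_iff' := by simp [lattice]; omega

/-- The translate of an edge set by `(k, l)`. -/
def shift (k l : ℤ) (E : Set (Sym2 (ℤ × ℤ))) : Set (Sym2 (ℤ × ℤ)) := Sym2.map (shiftIso k l) ⁻¹' E

/-- The mirror image of an edge set in a grid of width `m`. -/
def mirror (m : ℤ) (E : Set (Sym2 (ℤ × ℤ))) : Set (Sym2 (ℤ × ℤ)) := Sym2.map (mirrorIso m) ⁻¹' E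

/-- The mirror image of an edge set in the diagonal. -/
def transpose (E : Set (Sym2 (ℤ × ℤ))) : Set (Sym2 (ℤ × ℤ)) := Sym2.map swapIso ⁻¹' E

variable {k l m x y : ℤ}

theorem map_shiftIso_hEdge : Sym2.map (shiftIso k l) (hEdge x y) = hEdge (x - k) (y - l) := by
  rw [hEdge, hEdge, sub_add_eq_add_sub]; rfl

theorem map_shiftIso_vEdge : Sym2.map (shiftIso k l) (vEdge x y) = vEdge (x - k) (y - l) := by
  rw [vEdge, vEdge, sub_add_eq_add_sub]; rfl

theorem map_mirrorIso_hEdge : Sym2.map (mirrorIso m) (hEdge x y) = hEdge (m - x) y := by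
  rw [hEdge, hEdge, Sym2.eq_swap, sub_add_eq_add_sub, ← add_sub_add_right_eq_sub m x 1]; rfl

theorem map_mirrorIso_vEdge : Sym2.map (mirrorIso m) (vEdge x y) = vEdge (m + 1 - x) y := rfl

theorem hEdge_mem_shift {E : Set (Sym2 (ℤ × ℤ))} :
    hEdge x y ∈ shift k l E ↔ hEdge (x - k) (y - l) ∈ E := by
  rw [shift, Set.mem_preimage, map_shiftIso_hEdge]

theorem vEdge_mem_shift {E : Set (Sym2 (ℤ × ℤ))} :
    vEdge x y ∈ shift k l E ↔ vEdge (x - k) (y - l) ∈ E := by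
  rw [shift, Set.mem_preimage, map_shiftIso_vEdge]

theorem mem_endpoints_shift {E : Set (Sym2 (ℤ × ℤ))} {p : ℤ × ℤ} :
    p ∈ endpoints (shift k l E) ↔ (p.1 - k, p.2 - l) ∈ endpoints E :=
  iff_of_eq (congrArg (p ∈ ·) (endpoints_preimage_map (shiftIso k l).toEquiv E))

variable {R : Type*} [AddCommGroupWithOne R] (f : Sym2 (ℤ × ℤ) → R)

theorem cellSum_comp_shiftIso :
    cellSum (f ∘ Sym2.map (shiftIso k l)) x y = cellSum f (x - k) (y - l) := by
  simp only [cellSum, Function.comp_apply, map_shiftIso_hEdge, map_shiftIso_vEdge,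
    sub_add_eq_add_sub]

theorem cellSum_comp_mirrorIso :
    cellSum (f ∘ Sym2.map (mirrorIso m)) x y = cellSum f (m - x) y := by
  simp only [cellSum, Function.comp_apply, map_mirrorIso_hEdge, map_mirrorIso_vEdge,
    add_sub_add_right_eq_sub, sub_add_eq_add_sub]
  abel

theorem cellSum_comp_swapIso : cellSum (f ∘ Sym2.map swapIso) x y = cellSum f y x := by
  change f (vEdge y x) + f (vEdge (y + 1) x) + f (hEdge y x) + f (hEdge y (x + 1)) = _
  rw [cellSum]
  abel

end Symmetries

theorem edgeDiff_apply_eq_zero_iff {V : Type*} {E₁ E₂ : Set (Sym2 V)} {e : Sym2 V} :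
    edgeDiff E₁ E₂ e = 0 ↔ (e ∈ E₁ ↔ e ∈ E₂) := by
  by_cases h₁ : e ∈ E₁ <;> by_cases h₂ : e ∈ E₂ <;> simp [edgeDiff, h₁, h₂]

theorem edgeDiff_congr {V W : Type*} {E₁ E₂ : Set (Sym2 V)} {F₁ F₂ : Set (Sym2 W)} {e : Sym2 V}
    {f : Sym2 W} (h₁ : e ∈ E₁ ↔ f ∈ F₁) (h₂ : e ∈ E₂ ↔ f ∈ F₂) :
    edgeDiff E₁ E₂ e = edgeDiff F₁ F₂ f := by
  classical
  simp only [edgeDiff, Pi.sub_apply, Set.indicator_apply, h₁, h₂, Pi.one_apply]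

section Box

variable {m n : ℕ} {E E₁ E₂ : Set (Sym2 (ℤ × ℤ))} {x y : ℤ}

theorem hEdge_box_of_endpoints_subset (h : endpoints E ⊆ (grid m n).verts)
    (he : hEdge x y ∈ E) : 1 ≤ x ∧ x + 1 ≤ m ∧ 1 ≤ y ∧ y ≤ n := by
  have hleft := mem_verts_grid.1 (h (left_mem_endpoints he))
  have hright := mem_verts_grid.1 (h (right_mem_endpoints he))
  dsimp only at hleft hright
  omega

theorem vEdge_box_of_endpoints_subset (h : endpoints E ⊆ (grid m n).verts)
    (he : vEdge x y ∈ E) : 1 ≤ x ∧ x ≤ m ∧ 1 ≤ y ∧ y + 1 ≤ n := by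
  have hlower := mem_verts_grid.1 (h (left_mem_endpoints he))
  have hupper := mem_verts_grid.1 (h (right_mem_endpoints he))
  dsimp only at hlower hupper
  omega

theorem edgeDiff_hEdge_eq_zero (h₁ : endpoints E₁ ⊆ (grid m n).verts)
    (h₂ : endpoints E₂ ⊆ (grid m n).verts) (hxy : ¬(1 ≤ x ∧ x + 1 ≤ m ∧ 1 ≤ y ∧ y ≤ n)) :
    edgeDiff E₁ E₂ (hEdge x y) = 0 :=
  edgeDiff_apply_eq_zero_iff.2 (iff_of_false (fun he => hxy (hEdge_box_of_endpoints_subset h₁ he))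
    fun he => hxy (hEdge_box_of_endpoints_subset h₂ he))

theorem edgeDiff_vEdge_eq_zero (h₁ : endpoints E₁ ⊆ (grid m n).verts)
    (h₂ : endpoints E₂ ⊆ (grid m n).verts) (hxy : ¬(1 ≤ x ∧ x ≤ m ∧ 1 ≤ y ∧ y + 1 ≤ n)) :
    edgeDiff E₁ E₂ (vEdge x y) = 0 :=
  edgeDiff_apply_eq_zero_iff.2 (iff_of_false (fun he => hxy (vEdge_box_of_endpoints_subset h₁ he))
    fun he => hxy (vEdge_box_of_endpoints_subset h₂ he))

end Box

/-- The vertical edges of `E` on the left side of the grid, represented by their heights. The lower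
side of the grid is the left side of its transpose. -/
def leftSide (E : Set (Sym2 (ℤ × ℤ))) : Set ℤ := {y | vEdge 1 y ∈ E}

/-- The vertical edges of `E` on the right side of a grid of width `m`, represented by their
heights. The upper side of the grid is the right side of its transpose. -/
def rightSide (m : ℕ) (E : Set (Sym2 (ℤ × ℤ))) : Set ℤ := {y | vEdge m y ∈ E}

/-- `E₁` and `E₂` are the edge sets of two distinct cycles on the `m × n` grid which have the same
signature and which share an edge on each side of the grid. -/
structure Tile (m n : ℕ) (E₁ E₂ : Set (Sym2 (ℤ × ℤ))) : Prop where
  cycle₁ : IsCycleSet lattice E₁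
  cycle₂ : IsCycleSet lattice E₂
  box₁ : endpoints E₁ ⊆ (grid m n).verts
  box₂ : endpoints E₂ ⊆ (grid m n).verts
  ne : E₁ ≠ E₂
  sig : ∀ x y, (x, y) ∈ cells m n → cellSum (edgeDiff E₁ E₂) x y = 0
  left : (leftSide E₁ ∩ leftSide E₂).Nonempty
  right : (rightSide m E₁ ∩ rightSide m E₂).Nonempty
  bottom : (leftSide (transpose E₁) ∩ leftSide (transpose E₂)).Nonempty
  top : (rightSide n (transpose E₁) ∩ rightSide n (transpose E₂)).Nonempty

theorem leftSide_mirror (m : ℕ) (E : Set (Sym2 (ℤ × ℤ))) :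
    leftSide (mirror m E) = rightSide m E := by
  ext y
  rw [leftSide, rightSide, Set.mem_ofPred_eq, Set.mem_ofPred_eq, mirror, Set.mem_preimage,
    map_mirrorIso_vEdge, add_sub_cancel_right]

theorem rightSide_mirror (m : ℕ) (E : Set (Sym2 (ℤ × ℤ))) :
    rightSide m (mirror m E) = leftSide E := by
  ext y
  rw [leftSide, rightSide, Set.mem_ofPred_eq, Set.mem_ofPred_eq, mirror, Set.mem_preimage,
    map_mirrorIso_vEdge, add_sub_cancel_left]

theorem mirror_inter_nonempty {m : ℤ} {X₁ X₂ : Set (Sym2 (ℤ × ℤ))} {y : ℤ}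
    (h : ({x | hEdge x y ∈ X₁} ∩ {x | hEdge x y ∈ X₂}).Nonempty) :
    ({x | hEdge x y ∈ mirror m X₁} ∩ {x | hEdge x y ∈ mirror m X₂}).Nonempty := by
  obtain ⟨x, h₁, h₂⟩ := h
  refine ⟨m - x, ?_, ?_⟩
  all_goals rwa [Set.mem_ofPred_eq, mirror, Set.mem_preimage, map_mirrorIso_hEdge, sub_sub_cancel]

theorem preimage_map_injective {V W : Type*} (φ : V ≃ W) :
    Function.Injective fun E : Set (Sym2 W) => Sym2.map φ ⁻¹' E := by
  refine Set.preimage_injective.2 fun e => ⟨Sym2.map φ.symm e, ?_⟩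
  rw [Sym2.map_map, φ.self_comp_symm, Sym2.map_id, id]

theorem endpoints_mirror_subset {m n : ℕ} {E : Set (Sym2 (ℤ × ℤ))}
    (h : endpoints E ⊆ (grid m n).verts) : endpoints (mirror m E) ⊆ (grid m n).verts := by
  intro p hp
  have hbox : 1 ≤ (m : ℤ) + 1 - p.1 ∧ (m : ℤ) + 1 - p.1 ≤ m ∧ 1 ≤ p.2 ∧ p.2 ≤ n :=
    h ((endpoints_preimage_map (mirrorIso m).toEquiv E).subset hp)
  rw [mem_verts_grid]
  omega

theorem endpoints_transpose_subset {m n : ℕ} {E : Set (Sym2 (ℤ × ℤ))}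
    (h : endpoints E ⊆ (grid m n).verts) : endpoints (transpose E) ⊆ (grid n m).verts := by
  intro p hp
  obtain ⟨hx, hx', hy, hy'⟩ := h ((endpoints_preimage_map swapIso.toEquiv E).subset hp)
  exact ⟨hy, hy', hx, hx'⟩

theorem endpoints_shift_subset {m n : ℕ} {k l : ℤ} {E : Set (Sym2 (ℤ × ℤ))}
    (h : endpoints E ⊆ (grid m n).verts) {p : ℤ × ℤ} (hp : p ∈ endpoints (shift k l E)) :
    k + 1 ≤ p.1 ∧ p.1 ≤ k + m ∧ l + 1 ≤ p.2 ∧ p.2 ≤ l + n := by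
  have hbox := mem_verts_grid.1 (h (mem_endpoints_shift.1 hp))
  dsimp only at hbox
  omega

namespace Tile

variable {k m n : ℕ} {E₁ E₂ F₁ F₂ : Set (Sym2 (ℤ × ℤ))} {x y : ℤ}

theorem symm (h : Tile m n E₁ E₂) : Tile m n E₂ E₁ where
  cycle₁ := h.cycle₂
  cycle₂ := h.cycle₁
  box₁ := h.box₂
  box₂ := h.box₁
  ne := h.ne.symm
  sig x y hxy := by
    have hsig := h.sig x y hxy
    rw [edgeDiff, cellSum_sub] at hsig ⊢
    omega
  left := Set.inter_comm _ _ ▸ h.left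
  right := Set.inter_comm _ _ ▸ h.right
  bottom := Set.inter_comm _ _ ▸ h.bottom
  top := Set.inter_comm _ _ ▸ h.top

theorem mirror (h : Tile m n E₁ E₂) : Tile m n (mirror m E₁) (mirror m E₂) where
  cycle₁ := h.cycle₁.preimage_map _
  cycle₂ := h.cycle₂.preimage_map _
  box₁ := endpoints_mirror_subset h.box₁
  box₂ := endpoints_mirror_subset h.box₂
  ne := (preimage_map_injective (mirrorIso m).toEquiv).ne h.ne
  sig x y hxy := by
    rw [mem_cells] at hxy
    exact (cellSum_comp_mirrorIso _).trans (h.sig _ _ (mem_cells.2 (by omega)))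
  left := by rw [leftSide_mirror, leftSide_mirror]; exact h.right
  right := by rw [rightSide_mirror, rightSide_mirror]; exact h.left
  bottom := mirror_inter_nonempty h.bottom
  top := mirror_inter_nonempty h.top

theorem transpose (h : Tile m n E₁ E₂) : Tile n m (transpose E₁) (transpose E₂) where
  cycle₁ := h.cycle₁.preimage_map _
  cycle₂ := h.cycle₂.preimage_map _
  box₁ := endpoints_transpose_subset h.box₁
  box₂ := endpoints_transpose_subset h.box₂
  ne := (preimage_map_injective swapIso.toEquiv).ne h.ne
  sig x y hxy := by
    rw [mem_cells] at hxy
    exact (cellSum_comp_swapIso _).trans (h.sig _ _ (mem_cells.2 (by omega)))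
  left := h.bottom
  right := h.top
  bottom := h.left
  top := h.right

theorem two_le (h : Tile m n E₁ E₂) : 2 ≤ m := by
  obtain ⟨x, hx, -⟩ := h.bottom
  have hbox := hEdge_box_of_endpoints_subset h.box₁ (show hEdge x 1 ∈ E₁ from hx)
  omega

/-- Opposite sides match, so that the contributions of the two tiles to the cells between them
cancel. -/
theorem cellSum_edgeDiff_add_shift (hE : Tile k n E₁ E₂) (hF : Tile m n F₁ F₂)
    (h₁ : rightSide k E₁ = leftSide F₂) (h₂ : rightSide k E₂ = leftSide F₁)
    (hxy : (x, y) ∈ cells (k + m) n) :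
    cellSum (edgeDiff E₁ E₂ + edgeDiff (shift k 0 F₁) (shift k 0 F₂)) x y = 0 := by
  have hshift : edgeDiff (shift k 0 F₁) (shift k 0 F₂) =
    edgeDiff F₁ F₂ ∘ Sym2.map (shiftIso k 0) := rfl
  rw [mem_cells, Nat.cast_add] at hxy
  rw [cellSum_add, hshift, cellSum_comp_shiftIso, sub_zero]
  have hhE {x y} := edgeDiff_hEdge_eq_zero (x := x) (y := y) hE.box₁ hE.box₂
  have hvE {x y} := edgeDiff_vEdge_eq_zero (x := x) (y := y) hE.box₁ hE.box₂
  have hhF {x y} := edgeDiff_hEdge_eq_zero (x := x) (y := y) hF.box₁ hF.box₂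
  have hvF {x y} := edgeDiff_vEdge_eq_zero (x := x) (y := y) hF.box₁ hF.box₂
  rcases lt_trichotomy x k with hx | rfl | hx
  · rw [hE.sig x y (mem_cells.2 (by omega)), cellSum, hhF (by omega), hhF (by omega),
      hvF (by omega), hvF (by omega)]
    rfl
  · have hside : edgeDiff E₁ E₂ (vEdge k y) = edgeDiff F₂ F₁ (vEdge 1 y) :=
      edgeDiff_congr (Set.ext_iff.1 h₁ y) (Set.ext_iff.1 h₂ y)
    rw [cellSum, cellSum, hhE (by omega), hhE (by omega), hvE (x := k + 1) (by omega),
      hhF (by omega), hhF (by omega), hvF (x := k - k) (by omega), hside, edgeDiff_swap, sub_self,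
      zero_add]
    simp
  · rw [hF.sig (x - k) y (mem_cells.2 (by omega)), cellSum, hhE (by omega), hhE (by omega),
      hvE (by omega), hvE (by omega)]
    rfl

end Tile

/-- Two edge sets in adjacent grids, the left one of width `k`, merged along the square whose lower
left vertex is `(k, y₀)`. -/
def glue (k : ℕ) (y₀ : ℤ) (E F : Set (Sym2 (ℤ × ℤ))) : Set (Sym2 (ℤ × ℤ)) :=
  merge E (shift k 0 F) (k, y₀) (k, y₀ + 1) (k + 1, y₀) (k + 1, y₀ + 1)

section Glue

variable {k m n : ℕ} {E F : Set (Sym2 (ℤ × ℤ))} {x y y₀ : ℤ}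

theorem disjoint_endpoints_shift (hE : endpoints E ⊆ (grid k n).verts)
    (hF : endpoints F ⊆ (grid m n).verts) :
    Disjoint (endpoints E) (endpoints (shift k 0 F)) := by
  refine Set.disjoint_left.2 fun p hp hp' => ?_
  have hleft := mem_verts_grid.1 (hE hp)
  have hright := endpoints_shift_subset hF hp'
  omega

theorem vEdge_mem_shift_add_one (hy : y₀ ∈ leftSide F) : vEdge (k + 1) y₀ ∈ shift k 0 F := by
  rw [vEdge_mem_shift, add_sub_cancel_left, sub_zero]
  exact hy

theorem isCycleSet_glue (hE : IsCycleSet lattice E) (hF : IsCycleSet lattice F)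
    (hEbox : endpoints E ⊆ (grid k n).verts) (hFbox : endpoints F ⊆ (grid m n).verts)
    (hright : y₀ ∈ rightSide k E) (hleft : y₀ ∈ leftSide F) :
    IsCycleSet lattice (glue k y₀ E F) :=
  hE.merge (hF.preimage_map _) (disjoint_endpoints_shift hEbox hFbox) hright
    (vEdge_mem_shift_add_one hleft) (lattice_adj_right _ _) (lattice_adj_right _ _)

theorem endpoints_glue_subset (hE : endpoints E ⊆ (grid k n).verts)
    (hF : endpoints F ⊆ (grid m n).verts) (hright : y₀ ∈ rightSide k E) (hleft : y₀ ∈ leftSide F) :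
    endpoints (glue k y₀ E F) ⊆ (grid (k + m) n).verts := by
  intro p hp
  rw [mem_verts_grid]
  rcases endpoints_merge_subset hright (vEdge_mem_shift_add_one hleft) hp with hp | hp
  · have hbox := mem_verts_grid.1 (hE hp)
    omega
  · have hbox := endpoints_shift_subset hF hp
    omega

theorem glue_eq : glue k y₀ E F = ((E ∪ shift k 0 F) \ {vEdge k y₀, vEdge (k + 1) y₀}) ∪
    {hEdge k y₀, hEdge k (y₀ + 1)} := rfl

theorem hEdge_mem_glue (h : hEdge x y ∈ E ∨ hEdge (x - k) y ∈ F) : hEdge x y ∈ glue k y₀ E F := by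
  rw [glue_eq]
  refine .inl ⟨h.imp_right fun h => hEdge_mem_shift.2 (by rwa [sub_zero]), ?_⟩
  simp [hEdge_ne_vEdge]

theorem vEdge_mem_glue_iff (hx : x ≠ k) (hx' : x ≠ k + 1) :
    vEdge x y ∈ glue k y₀ E F ↔ vEdge x y ∈ E ∨ vEdge (x - k) y ∈ F := by
  have hshift : vEdge x y ∈ shift k 0 F ↔ vEdge (x - k) y ∈ F := by
    rw [vEdge_mem_shift, sub_zero]
  simp [glue_eq, hshift, vEdge_inj, hEdge_ne_vEdge.symm, hx, hx']

theorem leftSide_glue (hk : 2 ≤ k) (hF : endpoints F ⊆ (grid m n).verts) :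
    leftSide (glue k y₀ E F) = leftSide E := by
  ext y
  refine (vEdge_mem_glue_iff (by omega) (by omega)).trans (or_iff_left fun he => ?_)
  have hbox := vEdge_box_of_endpoints_subset hF he
  omega

theorem rightSide_glue (hm : 2 ≤ m) (hE : endpoints E ⊆ (grid k n).verts) :
    rightSide (k + m) (glue k y₀ E F) = rightSide m F := by
  ext y
  rw [rightSide, Nat.cast_add]
  refine (vEdge_mem_glue_iff (by omega) (by omega)).trans ?_
  rw [add_sub_cancel_left]
  refine or_iff_right fun he => ?_
  have hbox := vEdge_box_of_endpoints_subset hE he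
  omega

end Glue

namespace Tile

variable {k m n : ℕ} {E₁ E₂ F₁ F₂ : Set (Sym2 (ℤ × ℤ))}

theorem glue_ne (hE : Tile k n E₁ E₂) (hF : Tile m n F₁ F₂) {y₀ : ℤ}
    (hdiff : edgeDiff (glue k y₀ E₁ F₁) (glue k y₀ E₂ F₂) =
      edgeDiff E₁ E₂ + edgeDiff (shift k 0 F₁) (shift k 0 F₂)) :
    glue k y₀ E₁ F₁ ≠ glue k y₀ E₂ F₂ := by
  have hdisj {E F} (hE : endpoints E ⊆ (grid k n).verts) (hF : endpoints F ⊆ (grid m n).verts) :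
      Disjoint E (shift k 0 F) := disjoint_of_disjoint_endpoints (disjoint_endpoints_shift hE hF)
  intro heq
  refine hE.ne (Set.ext fun e => edgeDiff_apply_eq_zero_iff.1 ?_)
  by_cases he : e ∈ E₁ ∪ E₂
  · have hsum := congrFun hdiff e
    rwa [heq, Pi.add_apply, edgeDiff_apply_eq_zero_iff.2 Iff.rfl,
      edgeDiff_apply_eq_zero_iff (E₁ := shift k 0 F₁).2 ?_, add_zero, eq_comm] at hsum
    rcases he with he | he
    · exact iff_of_false (Set.disjoint_left.1 (hdisj hE.box₁ hF.box₁) he)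
        (Set.disjoint_left.1 (hdisj hE.box₁ hF.box₂) he)
    · exact iff_of_false (Set.disjoint_left.1 (hdisj hE.box₂ hF.box₁) he)
        (Set.disjoint_left.1 (hdisj hE.box₂ hF.box₂) he)
  · exact edgeDiff_apply_eq_zero_iff.2
      (iff_of_false (fun h => he (.inl h)) fun h => he (.inr h))

theorem exists_glue (hE : Tile k n E₁ E₂) (hF : Tile m n F₁ F₂)
    (h₁ : rightSide k E₁ = leftSide F₂) (h₂ : rightSide k E₂ = leftSide F₁) :
    ∃ S₁ S₂, Tile (k + m) n S₁ S₂ ∧ leftSide S₁ = leftSide E₁ ∧ leftSide S₂ = leftSide E₂ := by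
  obtain ⟨y₀, hy₁, hy₂⟩ := hE.right
  have hz₁ : y₀ ∈ leftSide F₁ := h₂ ▸ hy₂
  have hz₂ : y₀ ∈ leftSide F₂ := h₁ ▸ hy₁
  have hleft₁ := leftSide_glue (E := E₁) (y₀ := y₀) hE.two_le hF.box₁
  have hleft₂ := leftSide_glue (E := E₂) (y₀ := y₀) hE.two_le hF.box₂
  have hdiff : edgeDiff (glue k y₀ E₁ F₁) (glue k y₀ E₂ F₂) =
      edgeDiff E₁ E₂ + edgeDiff (shift k 0 F₁) (shift k 0 F₂) :=
    edgeDiff_merge (disjoint_endpoints_shift hE.box₁ hF.box₁)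
      (disjoint_endpoints_shift hE.box₂ hF.box₂) hy₁ hy₂ (vEdge_mem_shift_add_one hz₁)
      (vEdge_mem_shift_add_one hz₂)
  refine ⟨_, _, ⟨isCycleSet_glue hE.cycle₁ hF.cycle₁ hE.box₁ hF.box₁ hy₁ hz₁,
    isCycleSet_glue hE.cycle₂ hF.cycle₂ hE.box₂ hF.box₂ hy₂ hz₂,
    endpoints_glue_subset hE.box₁ hF.box₁ hy₁ hz₁, endpoints_glue_subset hE.box₂ hF.box₂ hy₂ hz₂,
    hE.glue_ne hF hdiff, fun x y hxy => hdiff ▸ hE.cellSum_edgeDiff_add_shift hF h₁ h₂ hxy,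
    ?_, ?_, ?_, ?_⟩, hleft₁, hleft₂⟩
  · rw [hleft₁, hleft₂]
    exact hE.left
  · rw [rightSide_glue hF.two_le hE.box₁, rightSide_glue hF.two_le hE.box₂]
    exact hF.right
  · exact hE.bottom.mono (Set.inter_subset_inter (fun _ h => hEdge_mem_glue (.inl h))
      fun _ h => hEdge_mem_glue (.inl h))
  · exact hE.top.mono (Set.inter_subset_inter (fun _ h => hEdge_mem_glue (.inl h))
      fun _ h => hEdge_mem_glue (.inl h))

theorem exists_row (hE : Tile m n E₁ E₂) {P : ℕ} (hP : 1 ≤ P) :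
    ∃ S₁ S₂, Tile (P * m) n S₁ S₂ ∧ leftSide S₁ = leftSide E₁ ∧ leftSide S₂ = leftSide E₂ := by
  induction P, hP using Nat.le_induction generalizing E₁ E₂ with
  | base => exact ⟨E₁, E₂, by rwa [one_mul], rfl, rfl⟩
  | succ P _ ih =>
    -- The next copy is reflected and the roles of its cycles are exchanged.
    obtain ⟨S₁, S₂, hS, hleft₁, hleft₂⟩ := ih hE.mirror.symm
    rw [leftSide_mirror] at hleft₁ hleft₂
    rw [add_one_mul, add_comm]
    exact hE.exists_glue hS hleft₂.symm hleft₁.symm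

theorem exists_mul (hE : Tile m n E₁ E₂) {P Q : ℕ} (hP : 1 ≤ P) (hQ : 1 ≤ Q) :
    ∃ S₁ S₂, Tile (P * m) (Q * n) S₁ S₂ := by
  obtain ⟨S₁, S₂, hS, -⟩ := hE.exists_row hP
  obtain ⟨T₁, T₂, hT, -⟩ := hS.transpose.exists_row hQ
  exact ⟨_, _, hT.transpose⟩

end Tile

/-! ### Explicit tiles -/

instance : DecidableRel lattice.Adj := fun p q => by
  unfold lattice
  infer_instance

/-- The edges between consecutive vertices of a list. -/
def listEdges {V : Type*} (l : List V) : List (Sym2 V) := List.zipWith (s(·, ·)) l l.tail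

theorem isCycleSet_listEdges {V : Type*} {G : SimpleGraph V} {l : List V} (hl : l.tail ≠ [])
    (hchain : l.IsChain G.Adj) (hclosed : l.head? = l.getLast?)
    (hedges : (listEdges l).Nodup) (htail : l.tail.Nodup) :
    IsCycleSet G {e | e ∈ listEdges l} := by
  have hne : l ≠ [] := by
    rintro rfl
    exact hl rfl
  have hsupport := SimpleGraph.Walk.support_ofSupport hne hchain
  generalize SimpleGraph.Walk.ofSupport l hne hchain = w at hsupport
  revert w
  rw [List.head?_eq_some_head hne, List.getLast?_eq_some_getLast hne, Option.some_inj] at hclosed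
  rw [hclosed]
  intro w hsupport
  have hwedges : w.edges = listEdges l := by
    rw [SimpleGraph.Walk.edges_eq_zipWith_support, hsupport, listEdges]
  refine ⟨_, w, w.isCycle_def.2 ⟨⟨hwedges ▸ hedges⟩, ?_, hsupport.symm ▸ htail⟩, ?_⟩
  · rintro rfl
    exact hl (hsupport ▸ rfl)
  · ext e
    exact hwedges ▸ Iff.rfl

theorem endpoints_listEdges_subset {V : Type*} (l : List V) :
    endpoints {e | e ∈ listEdges l} ⊆ {v | v ∈ l} := by
  rintro v ⟨e, he, hv⟩
  rw [Set.mem_ofPred_eq, listEdges, ← List.map_uncurry_zip_eq_zipWith, List.mem_map] at he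
  obtain ⟨⟨a, b⟩, hab, rfl⟩ := he
  obtain ⟨ha, hb⟩ := List.of_mem_zip hab
  rcases Sym2.mem_iff.1 hv with rfl | rfl
  exacts [ha, List.mem_of_mem_tail hb]

theorem edgeDiff_setOf_mem {V : Type*} [DecidableEq V] (L₁ L₂ : List (Sym2 V)) :
    edgeDiff {e | e ∈ L₁} {e | e ∈ L₂} =
      fun e => (if e ∈ L₁ then 1 else 0) - (if e ∈ L₂ then 1 else 0) := by
  classical
  ext e
  simp only [edgeDiff, Pi.sub_apply, Set.indicator_apply, Set.mem_ofPred_eq, Pi.one_apply]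

/-- `l` lists the vertices of a cycle on the `m × n` grid in cyclic order, with the first vertex
repeated at the end. All conditions are decidable. -/
abbrev IsPolygon (m n : ℕ) (l : List (ℤ × ℤ)) : Prop :=
  l.tail ≠ [] ∧ l.IsChain lattice.Adj ∧ l.head? = l.getLast? ∧ (listEdges l).Nodup ∧
    l.tail.Nodup ∧ ∀ p ∈ l, 1 ≤ p.1 ∧ p.1 ≤ m ∧ 1 ≤ p.2 ∧ p.2 ≤ n

namespace IsPolygon

variable {m n : ℕ} {l : List (ℤ × ℤ)}

theorem isCycleSet (h : IsPolygon m n l) : IsCycleSet lattice {e | e ∈ listEdges l} := by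
  obtain ⟨hl, hchain, hclosed, hedges, htail, -⟩ := h
  exact isCycleSet_listEdges hl hchain hclosed hedges htail

theorem endpoints_subset (h : IsPolygon m n l) :
    endpoints {e | e ∈ listEdges l} ⊆ (grid m n).verts := by
  obtain ⟨-, -, -, -, -, hbox⟩ := h
  exact fun p hp => hbox p (endpoints_listEdges_subset l hp)

end IsPolygon

theorem tile_listEdges {m n : ℕ} {l₁ l₂ : List (ℤ × ℤ)} (hl₁ : IsPolygon m n l₁)
    (hl₂ : IsPolygon m n l₂) (hne : ∃ e ∈ listEdges l₁, e ∉ listEdges l₂)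
    (hsig : ∀ x ∈ Finset.Ico (1 : ℤ) m, ∀ y ∈ Finset.Ico (1 : ℤ) n, cellSum (fun e =>
      (if e ∈ listEdges l₁ then 1 else 0) - (if e ∈ listEdges l₂ then (1 : ℤ) else 0)) x y = 0)
    (hleft : ∃ y ∈ Finset.Ico (1 : ℤ) n, vEdge 1 y ∈ listEdges l₁ ∧ vEdge 1 y ∈ listEdges l₂)
    (hright : ∃ y ∈ Finset.Ico (1 : ℤ) n, vEdge m y ∈ listEdges l₁ ∧ vEdge m y ∈ listEdges l₂)
    (hbottom : ∃ x ∈ Finset.Ico (1 : ℤ) m, hEdge x 1 ∈ listEdges l₁ ∧ hEdge x 1 ∈ listEdges l₂)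
    (htop : ∃ x ∈ Finset.Ico (1 : ℤ) m, hEdge x n ∈ listEdges l₁ ∧ hEdge x n ∈ listEdges l₂) :
    Tile m n {e | e ∈ listEdges l₁} {e | e ∈ listEdges l₂} where
  cycle₁ := hl₁.isCycleSet
  cycle₂ := hl₂.isCycleSet
  box₁ := hl₁.endpoints_subset
  box₂ := hl₂.endpoints_subset
  ne h := by
    obtain ⟨e, he₁, he₂⟩ := hne
    exact he₂ (h.subset he₁)
  sig x y hxy := by
    rw [mem_cells] at hxy
    rw [edgeDiff_setOf_mem]
    exact hsig x (Finset.mem_Ico.2 (by omega)) y (Finset.mem_Ico.2 (by omega))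
  left := hleft.imp fun _ h => h.2
  right := hright.imp fun _ h => h.2
  bottom := hbottom.imp fun _ h => h.2
  top := htop.imp fun _ h => h.2

/-- The first cycle of a tile of size `4 × 4`. -/
def four₁ : List (ℤ × ℤ) :=
  [(1, 1), (2, 1), (3, 1), (3, 2), (4, 2), (4, 3), (4, 4), (3, 4), (2, 4), (2, 3), (1, 3), (1, 2),
    (1, 1)]

/-- The second cycle of a tile of size `4 × 4`, the mirror image of the first one. -/
def four₂ : List (ℤ × ℤ) :=
  [(4, 1), (3, 1), (2, 1), (2, 2), (1, 2), (1, 3), (1, 4), (2, 4), (3, 4), (3, 3), (4, 3), (4, 2),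
    (4, 1)]

/-- The first cycle of a tile of size `6 × 4`, which fits to the left of the tile of size
`4 × 4` with its two cycles exchanged. -/
def six₁ : List (ℤ × ℤ) :=
  [(1, 1), (1, 2), (1, 3), (2, 3), (2, 4), (3, 4), (4, 4), (5, 4), (5, 3), (6, 3), (6, 2), (6, 1),
    (5, 1), (4, 1), (4, 2), (4, 3), (3, 3), (3, 2), (3, 1), (2, 1), (1, 1)]

/-- The second cycle of the tile of size `6 × 4`. -/
def six₂ : List (ℤ × ℤ) :=
  [(1, 2), (1, 3), (1, 4), (2, 4), (3, 4), (3, 3), (3, 2), (4, 2), (4, 3), (4, 4), (5, 4), (6, 4),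
    (6, 3), (6, 2), (5, 2), (5, 1), (4, 1), (3, 1), (2, 1), (2, 2), (1, 2)]

theorem tile_four : Tile 4 4 {e | e ∈ listEdges four₁} {e | e ∈ listEdges four₂} := by
  apply tile_listEdges <;> decide +kernel

theorem tile_six : Tile 6 4 {e | e ∈ listEdges six₁} {e | e ∈ listEdges six₂} := by
  apply tile_listEdges <;> decide +kernel

theorem rightSide_eq_leftSide {k m n : ℕ} {E F : Set (Sym2 (ℤ × ℤ))}
    (hE : endpoints E ⊆ (grid k n).verts) (hF : endpoints F ⊆ (grid m n).verts)
    (h : ∀ y ∈ Finset.Ico (1 : ℤ) n, vEdge k y ∈ E ↔ vEdge 1 y ∈ F) :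
    rightSide k E = leftSide F := by
  ext y
  by_cases hy : y ∈ Finset.Ico (1 : ℤ) n
  · exact h y hy
  rw [Finset.mem_Ico] at hy
  refine iff_of_false (fun he => ?_) fun he => ?_
  · have hbox := vEdge_box_of_endpoints_subset hE he
    omega
  · have hbox := vEdge_box_of_endpoints_subset hF he
    omega

theorem rightSide_six₁ :
    rightSide 6 {e | e ∈ listEdges six₁} = leftSide {e | e ∈ listEdges four₁} :=
  rightSide_eq_leftSide tile_six.box₁ tile_four.box₁ (by
    simp only [Set.mem_ofPred_eq]
    decide +kernel)

theorem rightSide_six₂ :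
    rightSide 6 {e | e ∈ listEdges six₂} = leftSide {e | e ∈ listEdges four₂} :=
  rightSide_eq_leftSide tile_six.box₂ tile_four.box₂ (by
    simp only [Set.mem_ofPred_eq]
    decide +kernel)

theorem exists_tile_six_add_mul_four (Q : ℕ) : ∃ S₁ S₂, Tile (6 + Q * 4) 4 S₁ S₂ := by
  rcases Nat.eq_zero_or_pos Q with rfl | hQ
  · exact ⟨_, _, tile_six⟩
  obtain ⟨F₁, F₂, hF, hleft₁, hleft₂⟩ := tile_four.symm.exists_row hQ
  obtain ⟨S₁, S₂, hS, -⟩ := tile_six.exists_glue hF (rightSide_six₁.trans hleft₂.symm)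
    (rightSide_six₂.trans hleft₁.symm)
  exact ⟨S₁, S₂, hS⟩

theorem exists_tile_of_even {m n : ℕ} (hm : 0 < m) (hn : 3 ≤ n) (hm4 : 4 ∣ m) (hn2 : 2 ∣ n) :
    ∃ S₁ S₂, Tile m n S₁ S₂ := by
  obtain ⟨P, rfl⟩ := hm4
  rw [mul_comm]
  by_cases hn4 : 4 ∣ n
  · obtain ⟨Q, rfl⟩ := hn4
    rw [mul_comm 4 Q]
    exact tile_four.exists_mul (by omega) (by omega)
  · obtain ⟨S₁, S₂, hS⟩ := exists_tile_six_add_mul_four ((n - 6) / 4)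
    rw [show 6 + (n - 6) / 4 * 4 = n by omega] at hS
    obtain ⟨T₁, T₂, hT, -⟩ := hS.transpose.exists_row (P := P) (by omega)
    exact ⟨T₁, T₂, hT⟩

/-! ### Cycles which differ along a diagonal -/

/-- The indicator function of the lower and left edges of the diagonal cells of the `e × e` grid
minus that of their upper and right edges, on the horizontal edge from `(x, y)` to `(x + 1, y)`. By
symmetry `diagonalDiff e y x` is its value on the vertical edge from `(x, y)` to `(x, y + 1)`. -/
def diagonalDiff (e x y : ℤ) : ℤ :=
  (if x = y ∧ 1 ≤ x ∧ x < e then 1 else 0) - (if y = x + 1 ∧ 1 ≤ x ∧ x < e then 1 else 0)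

/-- The edge sets of two cycles on the `e × e` grid which differ along the diagonal cells and which
share suitable edges on the sides. The first cycle avoids the upper right corner, so that another
cycle can be attached there. -/
structure DiagonalPair (e : ℕ) (E₁ E₂ : Set (Sym2 (ℤ × ℤ))) : Prop where
  cycle₁ : IsCycleSet lattice E₁
  cycle₂ : IsCycleSet lattice E₂
  box₁ : endpoints E₁ ⊆ (grid e e).verts
  box₂ : endpoints E₂ ⊆ (grid e e).verts
  corner : ((e, e) : ℤ × ℤ) ∉ endpoints E₁
  horiz : ∀ x y, edgeDiff E₁ E₂ (hEdge x y) = diagonalDiff e x y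
  vert : ∀ x y, edgeDiff E₁ E₂ (vEdge x y) = diagonalDiff e y x
  left : vEdge 1 2 ∈ E₁ ∧ vEdge 1 2 ∈ E₂
  bottom : hEdge 2 1 ∈ E₁ ∧ hEdge 2 1 ∈ E₂
  right : vEdge e (e - 2) ∈ E₁ ∧ vEdge e (e - 2) ∈ E₂
  top : hEdge (e - 2) e ∈ E₁ ∧ hEdge (e - 2) e ∈ E₂

theorem DiagonalPair.tile {e : ℕ} {E₁ E₂ : Set (Sym2 (ℤ × ℤ))} (h : DiagonalPair e E₁ E₂)
    (he : 2 ≤ e) : Tile e e E₁ E₂ where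
  cycle₁ := h.cycle₁
  cycle₂ := h.cycle₂
  box₁ := h.box₁
  box₂ := h.box₂
  ne := by
    rintro rfl
    have hdiff := h.horiz 1 1
    rw [edgeDiff_apply_eq_zero_iff.2 Iff.rfl, diagonalDiff, if_pos (by omega),
      if_neg (by omega)] at hdiff
    exact zero_ne_one hdiff
  sig x y hxy := by
    rw [mem_cells] at hxy
    rw [cellSum, h.horiz, h.horiz, h.vert, h.vert]
    simp only [diagonalDiff]
    split_ifs <;> omega
  left := ⟨2, h.left⟩
  right := ⟨e - 2, h.right⟩
  bottom := ⟨2, h.bottom⟩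
  top := ⟨e - 2, h.top⟩

/-- The first cycle of a diagonal pair of size `3`. -/
def three₁ : List (ℤ × ℤ) :=
  [(1, 1), (2, 1), (3, 1), (3, 2), (2, 2), (2, 3), (1, 3), (1, 2), (1, 1)]

/-- The second cycle of the diagonal pair of size `3`. -/
def three₂ : List (ℤ × ℤ) :=
  [(2, 2), (2, 1), (3, 1), (3, 2), (3, 3), (2, 3), (1, 3), (1, 2), (2, 2)]

theorem isPolygon_three₁ : IsPolygon 3 3 three₁ := by decide +kernel

theorem isPolygon_three₂ : IsPolygon 3 3 three₂ := by decide +kernel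

theorem edgeDiff_three_hEdge (x y : ℤ) :
    edgeDiff {e | e ∈ listEdges three₁} {e | e ∈ listEdges three₂} (hEdge x y) =
      diagonalDiff 3 x y := by
  by_cases h : x ∈ Finset.Ico (1 : ℤ) 3 ∧ y ∈ Finset.Ico (1 : ℤ) 4
  · obtain ⟨hx, hy⟩ := h
    rw [edgeDiff_setOf_mem]
    revert y
    revert x
    decide +kernel
  · rw [Finset.mem_Ico, Finset.mem_Ico] at h
    rw [edgeDiff_hEdge_eq_zero isPolygon_three₁.endpoints_subset isPolygon_three₂.endpoints_subset
      (by omega), diagonalDiff, if_neg (by omega), if_neg (by omega), sub_zero]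

theorem edgeDiff_three_vEdge (x y : ℤ) :
    edgeDiff {e | e ∈ listEdges three₁} {e | e ∈ listEdges three₂} (vEdge x y) =
      diagonalDiff 3 y x := by
  by_cases h : x ∈ Finset.Ico (1 : ℤ) 4 ∧ y ∈ Finset.Ico (1 : ℤ) 3
  · obtain ⟨hx, hy⟩ := h
    rw [edgeDiff_setOf_mem]
    revert y
    revert x
    decide +kernel
  · rw [Finset.mem_Ico, Finset.mem_Ico] at h
    rw [edgeDiff_vEdge_eq_zero isPolygon_three₁.endpoints_subset isPolygon_three₂.endpoints_subset
      (by omega), diagonalDiff, if_neg (by omega), if_neg (by omega), sub_zero]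

theorem notMem_endpoints_listEdges {V : Type*} {l : List V} {v : V} (h : v ∉ l) :
    v ∉ endpoints {e | e ∈ listEdges l} :=
  fun hv => h (endpoints_listEdges_subset l hv)

theorem diagonalPair_three :
    DiagonalPair 3 {e | e ∈ listEdges three₁} {e | e ∈ listEdges three₂} where
  cycle₁ := isPolygon_three₁.isCycleSet
  cycle₂ := isPolygon_three₂.isCycleSet
  box₁ := isPolygon_three₁.endpoints_subset
  box₂ := isPolygon_three₂.endpoints_subset
  corner := notMem_endpoints_listEdges (by decide +kernel)
  horiz := edgeDiff_three_hEdge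
  vert := edgeDiff_three_vEdge
  left := by simp only [Set.mem_ofPred_eq]; decide +kernel
  bottom := by simp only [Set.mem_ofPred_eq]; decide +kernel
  right := by simp only [Set.mem_ofPred_eq]; decide +kernel
  top := by simp only [Set.mem_ofPred_eq]; decide +kernel

/-- The edge set `E` with the edge `vEdge m y` replaced by the other three edges of the square on
its right. -/
def bump (m y : ℤ) (E : Set (Sym2 (ℤ × ℤ))) : Set (Sym2 (ℤ × ℤ)) :=
  detour E (m, y) (m, y + 1) (m + 1, y) (m + 1, y + 1)

section Bump

variable {m n : ℕ} {y : ℤ} {E E₁ E₂ : Set (Sym2 (ℤ × ℤ))}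

theorem notMem_endpoints_of_width_lt (h : endpoints E ⊆ (grid m n).verts) {p : ℤ × ℤ}
    (hp : m < p.1) : p ∉ endpoints E :=
  fun hpE => (mem_verts_grid.1 (h hpE)).2.1.not_gt hp

theorem mem_endpoints_bump (hy : vEdge m y ∈ E) {p : ℤ × ℤ} (hp : p ∈ endpoints (bump m y E)) :
    p ∈ endpoints E ∨ (p.1 = m + 1 ∧ y ≤ p.2 ∧ p.2 ≤ y + 1) := by
  refine (endpoints_detour_subset hy hp).imp_right ?_
  rintro (rfl | rfl) <;> simp

theorem endpoints_bump_subset (h : endpoints E ⊆ (grid m n).verts) (hy : vEdge m y ∈ E) :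
    endpoints (bump m y E) ⊆ (grid (m + 1) n).verts := by
  intro p hp
  have hbox := vEdge_box_of_endpoints_subset h hy
  rw [mem_verts_grid]
  rcases mem_endpoints_bump hy hp with hp | hp
  · have hpbox := mem_verts_grid.1 (h hp)
    omega
  · omega

theorem isCycleSet_bump (hE : IsCycleSet lattice E) (h : endpoints E ⊆ (grid m n).verts)
    (hy : vEdge m y ∈ E) : IsCycleSet lattice (bump m y E) :=
  hE.detour hy (notMem_endpoints_of_width_lt h (lt_add_one _))
    (notMem_endpoints_of_width_lt h (lt_add_one _)) (lattice_adj_right _ _) (lattice_adj_up _ _)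
    (lattice_adj_right _ _)

theorem edgeDiff_bump (h₁ : endpoints E₁ ⊆ (grid m n).verts) (h₂ : endpoints E₂ ⊆ (grid m n).verts)
    (hy₁ : vEdge m y ∈ E₁) (hy₂ : vEdge m y ∈ E₂) :
    edgeDiff (bump m y E₁) (bump m y E₂) = edgeDiff E₁ E₂ :=
  have h₁' {z} := notMem_endpoints_of_width_lt (p := (m + 1, z)) h₁ (lt_add_one _)
  have h₂' {z} := notMem_endpoints_of_width_lt (p := (m + 1, z)) h₂ (lt_add_one _)
  edgeDiff_detour hy₁ hy₂ h₁' h₂' h₁' h₂'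

end Bump

/-- `E` prolonged beyond the right side of a grid of width `m` by two adjacent bumps. -/
def hook (m : ℕ) (y : ℤ) (E : Set (Sym2 (ℤ × ℤ))) : Set (Sym2 (ℤ × ℤ)) :=
  bump (m + 1 : ℕ) y (bump m y E)

section Hook

variable {m n : ℕ} {y : ℤ} {E E₁ E₂ : Set (Sym2 (ℤ × ℤ))}

theorem vEdge_mem_bump : vEdge (m + 1 : ℕ) y ∈ bump m y E :=
  .inr (.inr (.inl (by rw [Nat.cast_add_one]; rfl)))

theorem hEdge_mem_hook : hEdge (m + 1) (y + 1) ∈ hook m y E :=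
  .inr (.inr (.inr (by rw [Nat.cast_add_one]; rfl)))

theorem mem_endpoints_hook (hy : vEdge m y ∈ E) {p : ℤ × ℤ} (hp : p ∈ endpoints (hook m y E)) :
    p ∈ endpoints E ∨ (m < p.1 ∧ p.1 ≤ m + 2 ∧ y ≤ p.2 ∧ p.2 ≤ y + 1) := by
  rcases mem_endpoints_bump vEdge_mem_bump hp with hp | hp
  · exact (mem_endpoints_bump hy hp).imp_right (by omega)
  · exact .inr (by omega)

theorem isCycleSet_hook (hE : IsCycleSet lattice E) (h : endpoints E ⊆ (grid m n).verts)
    (hy : vEdge m y ∈ E) : IsCycleSet lattice (hook m y E) :=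
  isCycleSet_bump (isCycleSet_bump hE h hy) (endpoints_bump_subset h hy) vEdge_mem_bump

theorem edgeDiff_hook (h₁ : endpoints E₁ ⊆ (grid m n).verts) (h₂ : endpoints E₂ ⊆ (grid m n).verts)
    (hy₁ : vEdge m y ∈ E₁) (hy₂ : vEdge m y ∈ E₂) :
    edgeDiff (hook m y E₁) (hook m y E₂) = edgeDiff E₁ E₂ :=
  (edgeDiff_bump (endpoints_bump_subset h₁ hy₁) (endpoints_bump_subset h₂ hy₂) vEdge_mem_bump
    vEdge_mem_bump).trans (edgeDiff_bump h₁ h₂ hy₁ hy₂)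

theorem mem_hook_of_mem (h : endpoints E ⊆ (grid m n).verts) {f : Sym2 (ℤ × ℤ)} (hf : f ∈ E)
    (hne : f ≠ vEdge m y) : f ∈ hook m y E := by
  refine .inl ⟨.inl ⟨hf, hne⟩, ?_⟩
  rintro rfl
  have hbox := vEdge_box_of_endpoints_subset h hf
  omega

end Hook

/-- The edge set `E` on the `e × e` grid together with the edge set `T` on the `3 × 3` grid with
lower left corner `(e, e)`: a hook on the right side of `E` is joined to `T` from below. -/
def extend (e : ℕ) (E T : Set (Sym2 (ℤ × ℤ))) : Set (Sym2 (ℤ × ℤ)) :=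
  merge (hook e (e - 2) E) (shift (e - 1) (e - 1) T) (e + 1, e - 1) (e + 1 + 1, e - 1) (e + 1, e)
    (e + 1 + 1, e)

section Extend

variable {e : ℕ} {x y : ℤ} {E T : Set (Sym2 (ℤ × ℤ))}

theorem extend_eq : extend e E T = ((hook e (e - 2) E ∪ shift (e - 1) (e - 1) T) \
    {hEdge (e + 1) (e - 1), hEdge (e + 1) e}) ∪
      {s(((e + 1, e - 1) : ℤ × ℤ), ((e + 1, e) : ℤ × ℤ)),
        s(((e + 1 + 1, e - 1) : ℤ × ℤ), ((e + 1 + 1, e) : ℤ × ℤ))} := rfl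

theorem hEdge_sub_one_mem_hook : hEdge (e + 1) (e - 1) ∈ hook e (e - 2) E := by
  convert hEdge_mem_hook using 2
  ring

theorem hEdge_mem_shift_sub_one (h : hEdge 2 1 ∈ T) :
    hEdge (e + 1) e ∈ shift (e - 1) (e - 1) T := by
  rw [hEdge_mem_shift]
  ring_nf
  exact h

theorem disjoint_endpoints_hook_shift (hE : endpoints E ⊆ (grid e e).verts)
    (hT : endpoints T ⊆ (grid 3 3).verts) (hright : vEdge e (e - 2) ∈ E)
    (hcorner : ((e, e) : ℤ × ℤ) ∉ endpoints E ∨ (1, 1) ∉ endpoints T) :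
    Disjoint (endpoints (hook e (e - 2) E)) (endpoints (shift (e - 1) (e - 1) T)) := by
  refine Set.disjoint_left.2 fun p hpE hpT => ?_
  have hpT' := endpoints_shift_subset hT hpT
  rcases mem_endpoints_hook hright hpE with hpE | hpE
  · have hpE' := mem_verts_grid.1 (hE hpE)
    obtain rfl : p = ((e : ℤ), (e : ℤ)) := Prod.ext (by dsimp only; omega) (by dsimp only; omega)
    rcases hcorner with hcorner | hcorner
    · exact hcorner hpE
    · rw [mem_endpoints_shift, sub_sub_cancel] at hpT
      exact hcorner hpT
  · omega

theorem isCycleSet_extend (hE : IsCycleSet lattice E) (hT : IsCycleSet lattice T)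
    (hEbox : endpoints E ⊆ (grid e e).verts) (hTbox : endpoints T ⊆ (grid 3 3).verts)
    (hright : vEdge e (e - 2) ∈ E) (hbottom : hEdge 2 1 ∈ T)
    (hcorner : ((e, e) : ℤ × ℤ) ∉ endpoints E ∨ (1, 1) ∉ endpoints T) :
    IsCycleSet lattice (extend e E T) :=
  (isCycleSet_hook hE hEbox hright).merge (hT.preimage_map _)
    (disjoint_endpoints_hook_shift hEbox hTbox hright hcorner) hEdge_sub_one_mem_hook
    (hEdge_mem_shift_sub_one hbottom) (by simp [lattice]) (by simp [lattice])

theorem mem_endpoints_extend (hright : vEdge e (e - 2) ∈ E) (hbottom : hEdge 2 1 ∈ T) {p : ℤ × ℤ}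
    (hp : p ∈ endpoints (extend e E T)) :
    p ∈ endpoints E ∨ (e < p.1 ∧ p.1 ≤ e + 2 ∧ e - 2 ≤ p.2 ∧ p.2 < e) ∨
      p ∈ endpoints (shift (e - 1) (e - 1) T) := by
  rcases endpoints_merge_subset hEdge_sub_one_mem_hook (hEdge_mem_shift_sub_one hbottom) hp with
    hp | hp
  · exact (mem_endpoints_hook hright hp).imp_right fun hp => .inl (by omega)
  · exact .inr (.inr hp)

theorem endpoints_extend_subset (hEbox : endpoints E ⊆ (grid e e).verts)
    (hTbox : endpoints T ⊆ (grid 3 3).verts) (hright : vEdge e (e - 2) ∈ E)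
    (hbottom : hEdge 2 1 ∈ T) :
    endpoints (extend e E T) ⊆ (grid (e + 2) (e + 2)).verts := by
  intro p hp
  have hbox := vEdge_box_of_endpoints_subset hEbox hright
  rw [mem_verts_grid]
  rcases mem_endpoints_extend hright hbottom hp with hp | hp | hp
  · have hpE := mem_verts_grid.1 (hEbox hp)
    omega
  · omega
  · have hpT := endpoints_shift_subset hTbox hp
    omega

theorem corner_notMem_endpoints_extend (hEbox : endpoints E ⊆ (grid e e).verts)
    (hright : vEdge e (e - 2) ∈ E) (hbottom : hEdge 2 1 ∈ T) (hT : (3, 3) ∉ endpoints T) :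
    (((e + 2 : ℕ), (e + 2 : ℕ)) : ℤ × ℤ) ∉ endpoints (extend e E T) := by
  intro hp
  rcases mem_endpoints_extend hright hbottom hp with hp | hp | hp
  · have hpE := mem_verts_grid.1 (hEbox hp)
    dsimp only at hpE
    omega
  · dsimp only at hp
    omega
  · rw [mem_endpoints_shift] at hp
    push_cast at hp
    ring_nf at hp
    exact hT hp

theorem mem_extend_of_mem_left (h : endpoints E ⊆ (grid e e).verts) {f : Sym2 (ℤ × ℤ)}
    (hf : f ∈ E) (hne : f ≠ vEdge e (e - 2)) : f ∈ extend e E T := by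
  rw [extend_eq]
  refine .inl ⟨.inl (mem_hook_of_mem h hf hne), ?_⟩
  rintro (rfl | rfl)
  all_goals
    have hbox := hEdge_box_of_endpoints_subset h hf
    omega

theorem hEdge_mem_extend_of_mem_right (hxy : hEdge (x - (e - 1)) (y - (e - 1)) ∈ T)
    (hy : (e : ℤ) < y) : hEdge x y ∈ extend e E T := by
  rw [extend_eq]
  refine .inl ⟨.inr (hEdge_mem_shift.2 hxy), ?_⟩
  rintro (h | h)
  all_goals
    have hheight := (hEdge_inj.1 h).2
    omega

theorem vEdge_mem_extend_of_mem_right (hxy : vEdge (x - (e - 1)) (y - (e - 1)) ∈ T) :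
    vEdge x y ∈ extend e E T := by
  rw [extend_eq]
  refine .inl ⟨.inr (vEdge_mem_shift.2 hxy), ?_⟩
  rintro (h | h)
  exacts [hEdge_ne_vEdge h.symm, hEdge_ne_vEdge h.symm]

end Extend

theorem diagonalDiff_add (e x y : ℤ) (he : 1 ≤ e) :
    diagonalDiff e x y + diagonalDiff 3 (x - (e - 1)) (y - (e - 1)) = diagonalDiff (e + 2) x y := by
  simp only [diagonalDiff]
  split_ifs <;> omega

namespace DiagonalPair

variable {e : ℕ} {E₁ E₂ T₁ T₂ : Set (Sym2 (ℤ × ℤ))}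

theorem edgeDiff_extend (hE : DiagonalPair e E₁ E₂) (hT : DiagonalPair 3 T₁ T₂)
    (hT₂ : (1, 1) ∉ endpoints T₂) : edgeDiff (extend e E₁ T₁) (extend e E₂ T₂) =
      edgeDiff E₁ E₂ + edgeDiff T₁ T₂ ∘ Sym2.map (shiftIso (e - 1) (e - 1)) := by
  rw [← edgeDiff_hook hE.box₁ hE.box₂ hE.right.1 hE.right.2]
  exact edgeDiff_merge
    (disjoint_endpoints_hook_shift hE.box₁ hT.box₁ hE.right.1 (.inl hE.corner))
    (disjoint_endpoints_hook_shift hE.box₂ hT.box₂ hE.right.2 (.inr hT₂)) hEdge_sub_one_mem_hook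
    hEdge_sub_one_mem_hook (hEdge_mem_shift_sub_one hT.bottom.1)
    (hEdge_mem_shift_sub_one hT.bottom.2)

theorem extend (hE : DiagonalPair e E₁ E₂) (he : 3 ≤ e) (hT : DiagonalPair 3 T₁ T₂)
    (hT₂ : (1, 1) ∉ endpoints T₂) : DiagonalPair (e + 2) (extend e E₁ T₁) (extend e E₂ T₂) where
  cycle₁ := isCycleSet_extend hE.cycle₁ hT.cycle₁ hE.box₁ hT.box₁ hE.right.1 hT.bottom.1
    (.inl hE.corner)
  cycle₂ := isCycleSet_extend hE.cycle₂ hT.cycle₂ hE.box₂ hT.box₂ hE.right.2 hT.bottom.2 (.inr hT₂)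
  box₁ := endpoints_extend_subset hE.box₁ hT.box₁ hE.right.1 hT.bottom.1
  box₂ := endpoints_extend_subset hE.box₂ hT.box₂ hE.right.2 hT.bottom.2
  corner := corner_notMem_endpoints_extend hE.box₁ hE.right.1 hT.bottom.1 hT.corner
  horiz x y := by
    rw [hE.edgeDiff_extend hT hT₂, Pi.add_apply, Function.comp_apply, map_shiftIso_hEdge,
      hE.horiz, hT.horiz, Nat.cast_add]
    exact diagonalDiff_add e x y (by omega)
  vert x y := by
    rw [hE.edgeDiff_extend hT hT₂, Pi.add_apply, Function.comp_apply, map_shiftIso_vEdge,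
      hE.vert, hT.vert, Nat.cast_add]
    exact diagonalDiff_add e y x (by omega)
  left := by
    have hne : vEdge 1 2 ≠ vEdge e (e - 2) := fun h => by
      rw [vEdge_inj] at h
      omega
    exact ⟨mem_extend_of_mem_left hE.box₁ hE.left.1 hne,
      mem_extend_of_mem_left hE.box₂ hE.left.2 hne⟩
  bottom := ⟨mem_extend_of_mem_left hE.box₁ hE.bottom.1 hEdge_ne_vEdge,
    mem_extend_of_mem_left hE.box₂ hE.bottom.2 hEdge_ne_vEdge⟩
  right := by
    refine hT.right.imp (fun h => vEdge_mem_extend_of_mem_right ?_)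
      fun h => vEdge_mem_extend_of_mem_right ?_
    all_goals
      convert h using 2 <;> push_cast <;> ring
  top := by
    refine hT.top.imp (fun h => hEdge_mem_extend_of_mem_right ?_ (by omega))
      fun h => hEdge_mem_extend_of_mem_right ?_ (by omega)
    all_goals
      convert h using 2 <;> push_cast <;> ring

end DiagonalPair

theorem exists_diagonalPair (j : ℕ) : ∃ E₁ E₂, DiagonalPair (2 * j + 3) E₁ E₂ := by
  induction j with
  | zero => exact ⟨_, _, diagonalPair_three⟩
  | succ j ih =>
    obtain ⟨E₁, E₂, hE⟩ := ih
    exact ⟨_, _, hE.extend (by omega) diagonalPair_three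
      (notMem_endpoints_listEdges (by decide +kernel))⟩

theorem exists_tile_of_odd {e P Q : ℕ} (he : 3 ≤ e) (hodd : Odd e) (hP : 1 ≤ P) (hQ : 1 ≤ Q) :
    ∃ S₁ S₂, Tile (P * e) (Q * e) S₁ S₂ := by
  obtain ⟨j, rfl⟩ : ∃ j, e = 2 * j + 3 := by
    obtain ⟨r, rfl⟩ := hodd
    exact ⟨r - 1, by omega⟩
  obtain ⟨E₁, E₂, hE⟩ := exists_diagonalPair j
  exact (hE.tile (by omega)).exists_mul hP hQ

/-! ### Existence and uniqueness -/

theorem IsCycleSet.exists_isGridCycle {m n : ℕ} {E : Set (Sym2 (ℤ × ℤ))}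
    (hE : IsCycleSet lattice E) (hbox : endpoints E ⊆ (grid m n).verts) :
    ∃ C : lattice.Subgraph, IsGridCycle m n C ∧ C.edgeSet = E := by
  obtain ⟨v, w, hw, rfl⟩ := hE
  refine ⟨w.toSubgraph, ⟨⟨fun p hp => ?_, fun p q hpq => ?_⟩, v, w, hw, rfl⟩,
    w.edgeSet_toSubgraph⟩
  · rw [SimpleGraph.Walk.mem_verts_toSubgraph,
      SimpleGraph.Walk.mem_support_iff_exists_mem_edges_of_not_nil hw.not_nil] at hp
    exact hbox hp
  · have he : s(p, q) ∈ w.edgeSet := by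
      rw [← w.edgeSet_toSubgraph]
      exact hpq
    exact ⟨hbox (left_mem_endpoints he), hbox (right_mem_endpoints he), w.toSubgraph.adj_sub hpq⟩

theorem Tile.exists_subgraphs {m n : ℕ} {E₁ E₂ : Set (Sym2 (ℤ × ℤ))} (h : Tile m n E₁ E₂) :
    ∃ C₁ C₂ : lattice.Subgraph,
      IsGridCycle m n C₁ ∧ IsGridCycle m n C₂ ∧ C₁ ≠ C₂ ∧ signature m n C₁ = signature m n C₂ := by
  obtain ⟨C₁, hC₁, rfl⟩ := h.cycle₁.exists_isGridCycle h.box₁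
  obtain ⟨C₂, hC₂, rfl⟩ := h.cycle₂.exists_isGridCycle h.box₂
  refine ⟨C₁, C₂, hC₁, hC₂, fun heq => h.ne (heq ▸ rfl), (signature_eq_iff ℤ).2 fun x y hxy => ?_⟩
  have hsig := h.sig x y hxy
  rwa [edgeDiff, cellSum_sub, sub_eq_zero] at hsig

theorem four_dvd_and_two_dvd_or {m n : ℕ} (hd : 2 ≤ Nat.gcd m n)
    (hodd : ∀ e, Odd e → e ∣ Nat.gcd m n → e < 3)
    (h4 : Nat.gcd m n = 2 → m ≡ 0 [MOD 4] ∨ n ≡ 0 [MOD 4]) :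
    (4 ∣ m ∧ 2 ∣ n) ∨ (4 ∣ n ∧ 2 ∣ m) := by
  obtain ⟨k, e, he, hgcd⟩ := Nat.exists_eq_two_pow_mul_odd (n := Nat.gcd m n) (by omega)
  obtain rfl : e = 1 := by
    have hlt := hodd e he (Dvd.intro_left _ hgcd.symm)
    obtain ⟨r, rfl⟩ := he
    omega
  rw [mul_one] at hgcd
  have hm := Nat.gcd_dvd_left m n
  have hn := Nat.gcd_dvd_right m n
  rw [hgcd] at hm hn
  match k with
  | 0 => omega
  | 1 =>
    have hmod := h4 hgcd
    rw [Nat.modEq_zero_iff_dvd, Nat.modEq_zero_iff_dvd] at hmod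
    rw [pow_one] at hm hn
    exact hmod.imp (⟨·, hn⟩) (⟨·, hm⟩)
  | k + 2 =>
    have h4pow : 4 ∣ 2 ^ (k + 2) := Dvd.intro_left (2 ^ k) (pow_add 2 k 2).symm
    have h4m := h4pow.trans hm
    have h4n := h4pow.trans hn
    omega

theorem exists_tile {m n : ℕ} (hm : 3 ≤ m) (hn : 3 ≤ n) (hd : 2 ≤ Nat.gcd m n)
    (h4 : Nat.gcd m n = 2 → m ≡ 0 [MOD 4] ∨ n ≡ 0 [MOD 4]) : ∃ S₁ S₂, Tile m n S₁ S₂ := by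
  by_cases hodd : ∃ e, Odd e ∧ e ∣ Nat.gcd m n ∧ 3 ≤ e
  · obtain ⟨e, he, hdvd, h3⟩ := hodd
    obtain ⟨P, rfl⟩ := hdvd.trans (Nat.gcd_dvd_left m n)
    obtain ⟨Q, rfl⟩ := hdvd.trans (Nat.gcd_dvd_right _ n)
    rw [mul_comm e P, mul_comm e Q]
    exact exists_tile_of_odd h3 he (Nat.pos_of_ne_zero (by rintro rfl; omega))
      (Nat.pos_of_ne_zero (by rintro rfl; omega))
  · push Not at hodd
    rcases four_dvd_and_two_dvd_or hd hodd h4 with ⟨hm4, hn2⟩ | ⟨hn4, hm2⟩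
    · exact exists_tile_of_even (by omega) hn hm4 hn2
    · obtain ⟨S₁, S₂, h⟩ := exists_tile_of_even (by omega) hm hn4 hm2
      exact ⟨_, _, h.transpose⟩

theorem exists_ne_signature_eq_iff {m n : ℕ} (hm : 0 < m) (hn : 0 < n) :
    (∃ C₁ C₂ : lattice.Subgraph, IsGridCycle m n C₁ ∧ IsGridCycle m n C₂ ∧ C₁ ≠ C₂ ∧
      signature m n C₁ = signature m n C₂) ↔
      (3 ≤ m ∧ 3 ≤ n) ∧ 2 ≤ Nat.gcd m n ∧
        (Nat.gcd m n = 2 → m ≡ 0 [MOD 4] ∨ n ≡ 0 [MOD 4]) := by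
  constructor
  · rintro ⟨C₁, C₂, hC₁, hC₂, hne, hsig⟩
    exact dimensions_of_signature_eq hC₁ hC₂ hne hsig hm hn
  · rintro ⟨⟨hm3, hn3⟩, hd, h4⟩
    obtain ⟨S₁, S₂, hS⟩ := exists_tile hm3 hn3 hd h4
    exact hS.exists_subgraphs

theorem unique_dimensions_iff_not_ambiguous_dimensions {m n : ℕ} (hm : 0 < m) :
    ((m ≤ 2 ∨ n ≤ 2) ∨ Nat.gcd m n = 1 ∨
        (Nat.gcd m n = 2 ∧ m ≡ 2 [MOD 4] ∧ n ≡ 2 [MOD 4])) ↔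
      ¬((3 ≤ m ∧ 3 ≤ n) ∧ 2 ≤ Nat.gcd m n ∧
        (Nat.gcd m n = 2 → m ≡ 0 [MOD 4] ∨ n ≡ 0 [MOD 4])) := by
  have hd : 0 < Nat.gcd m n := Nat.gcd_pos_of_pos_left _ hm
  have heven : Nat.gcd m n = 2 → 2 ∣ m ∧ 2 ∣ n := fun h =>
    ⟨h ▸ Nat.gcd_dvd_left m n, h ▸ Nat.gcd_dvd_right m n⟩
  simp only [Nat.ModEq]
  omega

end Slitherlink

theorem theorem6p1 (m n : ℕ) (hm : 0 < m) (hn : 0 < n) :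
    ((∀ C₁ C₂ : Slitherlink.lattice.Subgraph,
        Slitherlink.IsGridCycle m n C₁ → Slitherlink.IsGridCycle m n C₂ →
        Slitherlink.signature m n C₁ = Slitherlink.signature m n C₂ → C₁ = C₂) ↔
      (m ≤ 2 ∨ n ≤ 2) ∨ Nat.gcd m n = 1 ∨
        (Nat.gcd m n = 2 ∧ m ≡ 2 [MOD 4] ∧ n ≡ 2 [MOD 4])) ∧
    ((∃ C₁ C₂ : Slitherlink.lattice.Subgraph,
        Slitherlink.IsGridCycle m n C₁ ∧ Slitherlink.IsGridCycle m n C₂ ∧ C₁ ≠ C₂ ∧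
        Slitherlink.signature m n C₁ = Slitherlink.signature m n C₂) ↔
      (3 ≤ m ∧ 3 ≤ n) ∧ 2 ≤ Nat.gcd m n ∧
        (Nat.gcd m n = 2 → m ≡ 0 [MOD 4] ∨ n ≡ 0 [MOD 4])) := by
  have hambiguous := Slitherlink.exists_ne_signature_eq_iff hm hn
  refine ⟨?_, hambiguous⟩
  rw [Slitherlink.unique_dimensions_iff_not_ambiguous_dimensions hm, ← hambiguous]
  push Not
  exact forall₄_congr fun _ _ _ _ => not_imp_not.symm
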